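/- Let $P$ be the transition matrix of an ergodic (irreducible, aperiodic) Markov chain on $\{0,1,\dots,n\}$ that is reversible with respect to its stationary distribution $\pi$. Write $A_0$ for a matrix $A$ with row $0$ and column $0$ deleted, and $A_{\rm abs}$ for $A$ with row $0$ replaced by $\delta_0$. All vectors are row vectors, $\vec 1=(1,\dots,1)$. Let $\sigma(P)$, $\sigma(P_0)$ be the multisets of eigenvalues (all real). Remove the multiset $\sigma(P)\cap\sigma(P_0)$ from each. Let $r$ be the number of elements left of $\sigma(P_0)$, written $\gamma_1\ge\dots\ge\gamma_r$. Then $r+1$ elements are left of $\sigma(P)$; written $\lambda_0\ge\dots\ge\lambda_r$, they strictly interlace with the $\gamma_i$: $$1=\lambda_0>\gamma_1>\lambda_1>\dots>\gamma_r>\lambda_r .$$ Assume $\lambda_r\ge 0$ and put $\rho_i=\frac{1-\gamma_i}{1-\lambda_i}$ for $1\le i\le r$. On $\{0,\dots,r\}$ define, for $0\le k\le r$, vectors $\pi^*_k$ and $\hat\pi_k$, both vanishing at $i>k$, by $\pi^*_k(0)=\hat\pi_k(0)=\prod_{j=1}^k\rho_j$ and, for $1\le i\le k$, $$\pi^*_k(i)=(1-\rho_i)\prod_{1\le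 j\le k,\,j\ne i}\frac{1-\gamma_j-\rho_j(1-\gamma_i)}{\gamma_i-\gamma_j},\qquad \hat\pi_k(i)=(1-\rho_i)\prod_{j=i+1}^k\rho_j .$$ Put $\pi^*=\pi^*_r$ and $\hat\pi=\hat\pi_r$. Let $P^*$ be the star-chain matrix with, for $i\ge1$, $P^*(i,0)=1-\gamma_i$, $P^*(i,i)=\gamma_i$, $P^*(0,i)=(1-\gamma_i)\pi^*(i)/\pi^*(0)$, $P^*(0,0)=1-\sum_{i\ge1}P^*(0,i)$ and all other entries $0$. Let $\hat P$ be the matrix with $\hat P(0,0)=1$, $\hat P(i,i)=\gamma_i$ for $i\ge1$, $\hat P(i,j)=(1-\gamma_i)\hat\pi_{i-1}(j)$ for $j<i$, and $\hat P(i,j)=0$ for $j>i$. Let $\Lambda_2$ be the $(r+1)\times(r+1)$ matrix with row $0$ equal to $\delta_0$ and, for $i\ge1$, row $i$ equal to the vector $\nu_i$ determined by $\pi^*_i=\rho_i\pi^*_{i-1}+(1-\rho_i)\nu_i$. Let $D_0={\rm diag}(\pi(1),\dots,\pi(n))$, and let $\tilde U$ be an orthogonal $n\times n$ matrix with $\tilde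 U D_0^{1/2}P_0D_0^{-1/2}\tilde U^T={\rm diag}(\eta_1,\dots,\eta_n)$ (such $\tilde U$ exist). The rows $u_1,\dots,u_n$ of $\tilde UD_0^{1/2}$ form a basis of left eigenvectors of $P_0$; write $(\pi(1),\dots,\pi(n))=\sum_k a_ku_k$. Let $\Lambda_1$ be the $(r+1)\times(n+1)$ matrix with row $0$ equal to $\delta_0$ and row $i\ge1$ equal to $$\delta_0+\sum_{k:\,\eta_k=\gamma_i}\frac{a_k}{\pi^*(i)}\,(-u_k\vec1^{\,T}\mid u_k).$$ A matrix $\Lambda$ with rows summing to $1$ (entries of any sign) is called a quasi-link giving a quasi-intertwining of $(\mu,Q)$ and $(\mu',Q')$ if $\Lambda Q=Q'\Lambda$ and $\mu=\mu'\Lambda$; it is a link if it is also nonnegative. Then the following hold. 1. $\hat\pi$ is a probability distribution and $\hat P$ is a stochastic matrix; $\Lambda_2$ is a link giving a quasi-intertwining of $(\pi^*,P^*_{\rm abs})$ and $(\hat\pi,\hat P)$; for every choice of $\tilde U$, $\Lambda_1$ is a quasi-link giving a quasi-intertwining of $(\pi,P_{\rm abs})$ and $(\pi^*,P^*_{\rm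 abs})$; and for both matrices column $0$ is $\delta_0^T$. 2. For every choice of $\tilde U$, $\Lambda=\Lambda_2\Lambda_1$ is a quasi-link giving a quasi-intertwining of $(\pi,P_{\rm abs})$ and $(\hat\pi,\hat P)$, and $\Lambda\delta_0^T=\delta_0^T$. 3. The hitting time $T_0=\min\{t\ge0:X_t=0\}$ of the chain $X$ with initial distribution $\pi$ and transition matrix $P$ has the same law as the hitting time of $0$ of the chain with initial distribution $\hat\pi$ and transition matrix $\hat P$. 4. $T_0$ has the law of $\sum_{i=1}^rY_i$ with $Y_1,\dots,Y_r$ independent and $$Y_i\sim\rho_i\,\delta_0+(1-\rho_i)\,{\rm Geo}(1-\gamma_i),$$ where ${\rm Geo}(p)$ gives mass $(1-p)^{k-1}p$ to $k=1,2,\dots$. -/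

import Mathlib

open MeasureTheory ProbabilityTheory
open scoped ENNReal

noncomputable section

namespace InterlacedHitting

/-! ### Chains and reduced spectra -/

/-- `P` is the transition matrix of an ergodic (irreducible and aperiodic, i.e. primitive) chain on
`{0, …, n}` that is time-reversible with respect to its stationary distribution `π`. -/
structure IsReversibleErgodic {n : ℕ} (P : Matrix (Fin (n + 1)) (Fin (n + 1)) ℝ)
    (π : Fin (n + 1) → ℝ) : Prop where
  stochastic : P ∈ Matrix.rowStochastic ℝ (Fin (n + 1))
  ergodic : P.IsPrimitive
  distribution : π ∈ stdSimplex ℝ (Fin (n + 1))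
  stationary : Matrix.vecMul π P = π
  reversible : ∀ i j, π i * P i j = π j * P j i

/-- The principal submatrix obtained by deleting row `0` and column `0`. -/
def deleteZero {n : ℕ} (P : Matrix (Fin (n + 1)) (Fin (n + 1)) ℝ) : Matrix (Fin n) (Fin n) ℝ :=
  P.submatrix Fin.succ Fin.succ

/-- The transition matrix with state `0` turned into an absorbing state. -/
def absorb {n : ℕ} (P : Matrix (Fin (n + 1)) (Fin (n + 1)) ℝ) :
    Matrix (Fin (n + 1)) (Fin (n + 1)) ℝ :=
  P.updateRow 0 (Pi.single 0 1)

/-- The multiset of real eigenvalues, with algebraic multiplicity. -/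
def spec {m : ℕ} (A : Matrix (Fin m) (Fin m) ℝ) : Multiset ℝ := A.charpoly.roots

/-- The spectrum of `P` after cancellation of the common part with the spectrum of the principal
submatrix. -/
def reducedSpec {n : ℕ} (P : Matrix (Fin (n + 1)) (Fin (n + 1)) ℝ) : Multiset ℝ :=
  spec P - spec P ∩ spec (deleteZero P)

/-- The spectrum of the principal submatrix after the same cancellation. -/
def reducedSpecZero {n : ℕ} (P : Matrix (Fin (n + 1)) (Fin (n + 1)) ℝ) : Multiset ℝ :=
  spec (deleteZero P) - spec P ∩ spec (deleteZero P)

/-- The number `r` of eigenvalues left in the spectrum of the principal submatrix. -/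
def reducedCard {n : ℕ} (P : Matrix (Fin (n + 1)) (Fin (n + 1)) ℝ) : ℕ :=
  (reducedSpecZero P).card

/-- `λ₀ ≥ λ₁ ≥ ⋯ ≥ λ_r`: the reduced eigenvalues of `P` in decreasing order
(values at indices past the end are irrelevant). -/
def reducedLam {n : ℕ} (P : Matrix (Fin (n + 1)) (Fin (n + 1)) ℝ) (i : ℕ) : ℝ :=
  ((reducedSpec P).sort (· ≥ ·)).getD i 0

/-- `γ₁ ≥ ⋯ ≥ γ_r`: the reduced eigenvalues of the principal submatrix in decreasing order, numbered
from `1` (values at index `0` and at indices past the end are irrelevant). -/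
def reducedGam {n : ℕ} (P : Matrix (Fin (n + 1)) (Fin (n + 1)) ℝ) (i : ℕ) : ℝ :=
  ((reducedSpecZero P).sort (· ≥ ·)).getD (i - 1) 0

/-! ### Quasi-intertwinings -/

/-- `Λ` (rows summing to one, entries of any sign) is a quasi-link providing a quasi-intertwining of
`(π, P)` and `(π', P')`. -/
structure IsQuasiIntertwining {m n : ℕ} (Λ : Matrix (Fin m) (Fin n) ℝ)
    (π : Fin n → ℝ) (P : Matrix (Fin n) (Fin n) ℝ)
    (π' : Fin m → ℝ) (P' : Matrix (Fin m) (Fin m) ℝ) : Prop where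
  row_sum : ∀ i, ∑ j, Λ i j = 1
  intertwine : Λ * P = P' * Λ
  initial : π = Matrix.vecMul π' Λ

/-- The column of `Λ` at state `0` is the indicator of the dual state `0`. -/
def MatchesZero {m n : ℕ} (Λ : Matrix (Fin (m + 1)) (Fin (n + 1)) ℝ) : Prop :=
  ∀ i, Λ i 0 = if i = 0 then 1 else 0

/-! ### The star chain and the downward chain

Both live on `{0, …, r}` and depend on sequences `ρ` and `γ`, used at the indices `1, …, r`. -/

/-- The distribution `π*_k` on `{0, …, r}`, for `0 ≤ k ≤ r`. -/
def starDist (r : ℕ) (ρ γ : ℕ → ℝ) (k : ℕ) : Fin (r + 1) → ℝ := fun i =>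
  if (i : ℕ) = 0 then ∏ j ∈ Finset.Icc 1 k, ρ j
  else if (i : ℕ) ≤ k then
    (1 - ρ i) * ∏ j ∈ (Finset.Icc 1 k).erase (i : ℕ), (1 - γ j - ρ j * (1 - γ i)) / (γ i - γ j)
  else 0

/-- The transition matrix `P*` of the star chain, with hub `0`. -/
def starMatrix (r : ℕ) (ρ γ : ℕ → ℝ) : Matrix (Fin (r + 1)) (Fin (r + 1)) ℝ := fun i j =>
  if i = 0 then
    if j = 0 then
      1 - (1 / starDist r ρ γ r 0) *
        ∑ l ∈ Finset.univ.erase (0 : Fin (r + 1)), (1 - γ l) * starDist r ρ γ r l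
    else (1 - γ j) * starDist r ρ γ r j / starDist r ρ γ r 0
  else if j = 0 then 1 - γ i
  else if j = i then γ i
  else 0

/-- The vector `ν_i`, i.e. the unique solution of `π*_i = ρ_i π*_{i-1} + (1 - ρ_i) ν_i`. -/
def nu (r : ℕ) (ρ γ : ℕ → ℝ) (i : ℕ) : Fin (r + 1) → ℝ := fun j =>
  (starDist r ρ γ i j - ρ i * starDist r ρ γ (i - 1) j) / (1 - ρ i)

/-- The matrix `Λ₂`: row `0` is the point mass at `0`, row `i ≥ 1` is `ν_i`. -/
def linkTwo (r : ℕ) (ρ γ : ℕ → ℝ) : Matrix (Fin (r + 1)) (Fin (r + 1)) ℝ := fun i =>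
  if i = 0 then Pi.single 0 1 else nu r ρ γ i

/-- The distribution `π̂_k` on `{0, …, r}`, for `0 ≤ k ≤ r`. -/
def hatDist (r : ℕ) (ρ : ℕ → ℝ) (k : ℕ) : Fin (r + 1) → ℝ := fun j =>
  if (j : ℕ) = 0 then ∏ l ∈ Finset.Icc 1 k, ρ l
  else if (j : ℕ) ≤ k then (1 - ρ j) * ∏ l ∈ Finset.Icc ((j : ℕ) + 1) k, ρ l
  else 0

/-- The transition matrix `P̂` of the downward chain. -/
def hatMatrix (r : ℕ) (ρ γ : ℕ → ℝ) : Matrix (Fin (r + 1)) (Fin (r + 1)) ℝ := fun i j =>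
  if i < j then 0
  else if j = i then (if i = 0 then 1 else γ i)
  else (1 - γ i) * hatDist r ρ ((i : ℕ) - 1) j

/-! ### The quasi-link `Λ₁` to the star chain -/

/-- The rows of the orthogonal matrix `U` are orthonormal left eigenvectors, with eigenvalues `η`, of
the symmetric matrix `S₀ = D₀^{1/2} P₀ D₀^{-1/2}`, where `D₀ = diag (π 1, …, π n)` and `P₀` is the
principal submatrix of `P`. -/
structure IsEigenframe {n : ℕ} (P : Matrix (Fin (n + 1)) (Fin (n + 1)) ℝ) (π : Fin (n + 1) → ℝ)
    (U : Matrix (Fin n) (Fin n) ℝ) (η : Fin n → ℝ) : Prop where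
  orthogonal : U * U.transpose = 1
  eigen : U * (Matrix.diagonal (fun m : Fin n => √(π m.succ)) * deleteZero P *
      Matrix.diagonal (fun m : Fin n => (√(π m.succ))⁻¹)) * U.transpose = Matrix.diagonal η

/-- Row `k` of `U D₀^{1/2}`, a left eigenvector `u_k` of the principal submatrix of `P`. -/
def eigRow {n : ℕ} (π : Fin (n + 1) → ℝ) (U : Matrix (Fin n) (Fin n) ℝ) (k : Fin n) : Fin n → ℝ :=
  fun m => U k m * √(π m.succ)

/-- The coordinate of `(π 1, …, π n)` along the eigenvector `u_k`. -/
def eigCoord {n : ℕ} (π : Fin (n + 1) → ℝ) (U : Matrix (Fin n) (Fin n) ℝ) (k : Fin n) : ℝ :=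
  ∑ m : Fin n, √(π m.succ) * U k m

/-- The matrix `Λ₁`: row `0` is the point mass `δ₀`, and row `i ≥ 1` is
`δ₀ + ∑_{k : η_k = γ_i} c_k (- u_k 1ᵀ | u_k)`, where `π*(i) c_k` is the coordinate of `(π 1, …, π n)`
along `u_k`. -/
def linkOne {n : ℕ} (r : ℕ) (ρ γ : ℕ → ℝ) (π : Fin (n + 1) → ℝ)
    (U : Matrix (Fin n) (Fin n) ℝ) (η : Fin n → ℝ) : Matrix (Fin (r + 1)) (Fin (n + 1)) ℝ := fun i =>
  if i = 0 then Pi.single 0 1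
  else Pi.single 0 1 + ∑ k ∈ Finset.univ.filter (fun k : Fin n => η k = γ i),
    (eigCoord π U k / starDist r ρ γ r i) •
      (Fin.cons (-∑ m, eigRow π U k m) (eigRow π U k) : Fin (n + 1) → ℝ)

/-! ### Hitting times -/

/-- Under the probability measure `μ`, `X` is a Markov chain on `{0, …, n}` with initial
distribution `π` and transition matrix `P`. -/
structure IsMarkovChain {Ω : Type*} [MeasurableSpace Ω] (μ : Measure Ω) {n : ℕ}
    (X : ℕ → Ω → Fin (n + 1)) (π : Fin (n + 1) → ℝ) (P : Matrix (Fin (n + 1)) (Fin (n + 1)) ℝ) :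
    Prop where
  isProbabilityMeasure : IsProbabilityMeasure μ
  measurable : ∀ t, Measurable (X t)
  law : ∀ (t : ℕ) (x : ℕ → Fin (n + 1)), μ {ω | ∀ s ≤ t, X s ω = x s} =
    ENNReal.ofReal (π (x 0) * ∏ s ∈ Finset.range t, P (x s) (x (s + 1)))

/-- The first time `t ≥ 0` with `X t = 0`, and `⊤` if there is none. -/
def hitZero {Ω : Type*} {n : ℕ} (X : ℕ → Ω → Fin (n + 1)) : Ω → ℕ∞ :=
  MeasureTheory.hittingAfter X {0} 0

/-- The geometric distribution on `{1, 2, …}` with success probability `p ∈ [0, 1]`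
(Mathlib's counts failures and lives on `{0, 1, …}`). -/
def geo (p : ℝ) : Measure ℕ :=
  (geometricMeasure (Set.projIcc 0 1 zero_le_one p)).map (· + 1)

/-- The modified geometric distribution `ρ δ₀ + (1 - ρ) Geo(p)`. -/
def modifiedGeo (ρ p : ℝ) : Measure ℕ :=
  ENNReal.ofReal ρ • Measure.dirac 0 + ENNReal.ofReal (1 - ρ) • geo p

end InterlacedHitting

end

/-!
Expand `(π 1, …, π n)` in left eigenvectors of the principal submatrix `P₀`, orthogonal after
symmetrization, and let `m x ≥ 0` be the total mass of its component for the eigenvalue `x`. Then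
`det (z - P) / det (z - P₀) = (z - 1) * (π 0 + ∑ m x * (1 - x) / (z - x)) / π 0`, where only the
`x` with `m x > 0` contribute. These `x` are therefore the `γ i`, the `λ i` with `i ≥ 1` are the
zeros of the bracket, and the signs of its residues give the strict interlacing. Writing the
bracket as `π 0 * ∏ (z - λ i) / (z - γ i)`, its value at `1` yields `π 0 = ∏ ρ i` and its residues
yield `m (γ i) = π* i`, so the normalized eigencomponents are the rows of a quasi-link between the
absorbed chain and the star chain. A partial fraction expansion shows that `π*_k` has total mass
one, so the `ν_i` have too and link the star chain to the downward chain. Quasi-links with column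
`0` equal to `δ₀ᵀ` preserve absorption probabilities, and the downward chain waits a geometric
time in each state `i ≥ 1` before restarting from `π̂_{i-1}`, which gives the sum of modified
geometric times.
-/

noncomputable section

namespace InterlacedHitting

open Matrix Polynomial

section PartialFractions

variable {K ι : Type*} [Field K]

lemma coeff_prod_C_mul_X_sub_C (s : Finset ι) (a b : ι → K) :
    (∏ i ∈ s, (C (a i) * X - C (b i))).coeff s.card = ∏ i ∈ s, a i := by
  have h := coeff_prod_of_natDegree_le (s := s) (f := fun i => C (a i) * X - C (b i)) 1
    fun i _ => by compute_degree
  simpa only [mul_one, coeff_sub, coeff_C_mul, coeff_X_one, coeff_C_succ, sub_zero] using h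

lemma natDegree_prod_C_mul_X_sub_C_le (s : Finset ι) (a b : ι → K) :
    (∏ i ∈ s, (C (a i) * X - C (b i))).natDegree ≤ s.card :=
  (natDegree_prod_le _ _).trans <|
    (Finset.sum_le_card_nsmul _ _ 1 fun i _ => by compute_degree).trans (by simp)

/-- Both products have the same leading coefficient, so that their difference is interpolated by its
values at the nodes. -/
lemma degree_prod_sub_C_mul_nodal_lt (s : Finset ι) (a b x : ι → K) :
    (∏ i ∈ s, (C (a i) * X - C (b i)) - C (∏ i ∈ s, a i) * Lagrange.nodal s x).degree < s.card := by
  rw [degree_lt_iff_coeff_zero]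
  intro m hm
  have hnodal := coeff_prod_C_mul_X_sub_C s (fun _ => (1 : K)) x
  have hnodal' := natDegree_prod_C_mul_X_sub_C_le s (fun _ => (1 : K)) x
  simp only [C_1, one_mul, Finset.prod_const_one, ← Lagrange.nodal_eq] at hnodal hnodal'
  rw [coeff_sub, coeff_C_mul]
  rcases hm.eq_or_lt with rfl | hm
  · rw [coeff_prod_C_mul_X_sub_C, hnodal, mul_one, sub_self]
  · rw [coeff_eq_zero_of_natDegree_lt ((natDegree_prod_C_mul_X_sub_C_le s a b).trans_lt hm),
      coeff_eq_zero_of_natDegree_lt (hnodal'.trans_lt hm), mul_zero, sub_zero]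

lemma prod_add_sum_prod_div_eq_one [DecidableEq ι] {s : Finset ι} {x : ι → K} (ρ : ι → K)
    (hx : Set.InjOn x s) (h0 : ∀ i ∈ s, x i ≠ 0) :
    ∏ i ∈ s, ρ i +
      ∑ i ∈ s, (1 - ρ i) * ∏ j ∈ s.erase i, (ρ j * x i - x j) / (x i - x j) = 1 := by
  have key := Lagrange.eval_interpolate_not_at_node (fun i => ∏ j ∈ s, (ρ j * x i - x j))
    fun i hi => (h0 i hi).symm
  rw [← Lagrange.eq_interpolate_of_eval_eq _ hx
    (degree_prod_sub_C_mul_nodal_lt s ρ x x) fun i hi => by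
      simp [eval_prod, Lagrange.eval_nodal_at_node hi]] at key
  have hprod : ∏ i ∈ s, -x i ≠ 0 := Finset.prod_ne_zero_iff.2 fun i hi => neg_ne_zero.2 (h0 i hi)
  simp only [eval_sub, eval_prod, eval_mul, eval_C, eval_X, mul_zero, zero_sub,
    Lagrange.eval_nodal] at key
  have hsum : ∑ i ∈ s, Lagrange.nodalWeight s x i * (-x i)⁻¹ * ∏ j ∈ s, (ρ j * x i - x j) =
      ∑ i ∈ s, (1 - ρ i) * ∏ j ∈ s.erase i, (ρ j * x i - x j) / (x i - x j) := by
    refine Finset.sum_congr rfl fun i hi => ?_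
    have := h0 i hi
    rw [← Finset.mul_prod_erase _ _ hi, Lagrange.nodalWeight, Finset.prod_div_distrib,
      Finset.prod_inv_distrib]
    field_simp
    ring
  rw [hsum] at key
  exact mul_left_cancel₀ hprod (by linear_combination -key)

end PartialFractions

section RowSums

variable {R ι κ : Type*} [CommRing R] [Fintype ι] [Fintype κ]

lemma sum_vecMul_of_row_sum {A : Matrix ι κ R} (hA : ∀ i, ∑ j, A i j = 1) (v : ι → R) :
    ∑ j, (v ᵥ* A) j = ∑ i, v i := by
  simp only [vecMul, dotProduct]
  rw [Finset.sum_comm]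
  simp only [← Finset.mul_sum, hA, mul_one]

lemma eq_of_sum_eq_of_forall_ne {v w : ι → R} (hsum : ∑ j, v j = ∑ j, w j) (i : ι)
    (h : ∀ j, j ≠ i → v j = w j) : v = w := by
  classical
  rw [Fintype.sum_eq_add_sum_compl i, Fintype.sum_eq_add_sum_compl i,
    Finset.sum_congr rfl fun j hj => h j (by simpa using hj), add_left_inj] at hsum
  funext j
  rcases eq_or_ne j i with rfl | hj
  · exact hsum
  · exact h j hj

end RowSums

/-! ### The star chain and the downward chain -/

section StarAndDownward

variable {r : ℕ} (ρ γ : ℕ → ℝ)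

lemma val_mem_Icc {i : Fin (r + 1)} (hi : i ≠ 0) : (i : ℕ) ∈ Set.Icc 1 r :=
  ⟨Nat.one_le_iff_ne_zero.2 (Fin.val_ne_zero_iff.2 hi), i.is_le⟩

lemma val_succ_mem_Icc (i : Fin r) : (i : ℕ) + 1 ∈ Set.Icc 1 r :=
  ⟨Nat.le_add_left _ _, i.is_lt⟩

lemma starDist_apply_zero (k : ℕ) : starDist r ρ γ k 0 = ∏ j ∈ Finset.Icc 1 k, ρ j :=
  if_pos rfl

lemma starDist_of_lt {k : ℕ} {i : Fin (r + 1)} (h : k < i) : starDist r ρ γ k i = 0 := by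
  rw [starDist, if_neg (by lia), if_neg (by lia)]

lemma starDist_zero : starDist r ρ γ 0 = Pi.single 0 1 := by
  funext i
  rcases eq_or_ne i 0 with rfl | hi
  · simp [starDist_apply_zero]
  · rw [starDist_of_lt ρ γ (val_mem_Icc hi).1, Pi.single_eq_of_ne hi]

lemma starDist_succ {k : ℕ} {i : Fin (r + 1)} (hi : i ≠ 0) (hik : i ≤ k) :
    starDist r ρ γ (k + 1) i = starDist r ρ γ k i *
      ((1 - γ (k + 1) - ρ (k + 1) * (1 - γ i)) / (γ i - γ (k + 1))) := by
  have herase : (Finset.Icc 1 (k + 1)).erase (i : ℕ) =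
      insert (k + 1) ((Finset.Icc 1 k).erase (i : ℕ)) := by
    grind
  have hi' := Fin.val_ne_zero_iff.2 hi
  rw [starDist, starDist, if_neg hi', if_pos (by lia), if_neg hi', if_pos hik, herase,
    Finset.prod_insert (by simp)]
  ring

lemma sum_univ_ite_eq_zero_ite_le {k : ℕ} (hk : k ≤ r) (a : ℝ) (g : ℕ → ℝ) :
    ∑ i : Fin (r + 1), (if (i : ℕ) = 0 then a else if (i : ℕ) ≤ k then g i else 0) =
      a + ∑ i ∈ Finset.Icc 1 k, g i := by
  rw [Fin.sum_univ_eq_sum_range (fun i => if i = 0 then a else if i ≤ k then g i else 0),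
    Finset.range_eq_Ico, Finset.sum_eq_sum_Ico_succ_bot r.succ_pos, if_pos rfl, zero_add]
  congr 1
  refine (Finset.sum_subset_zero_on_sdiff ?_ ?_ ?_).symm <;> grind

variable {ρ γ}

lemma sum_starDist (hγ : Set.InjOn γ (Set.Icc 1 r)) (hγ1 : ∀ i ∈ Set.Icc 1 r, γ i ≠ 1) {k : ℕ}
    (hk : k ≤ r) : ∑ i, starDist r ρ γ k i = 1 := by
  have hsub : (Finset.Icc 1 k : Set ℕ) ⊆ Set.Icc 1 r := by
    rw [Finset.coe_Icc]
    exact Set.Icc_subset_Icc_right hk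
  have key := prod_add_sum_prod_div_eq_one (x := fun i => γ i - 1) ρ
    (fun i hi j hj hij => hγ (hsub hi) (hsub hj) (sub_left_injective hij))
    fun i hi => sub_ne_zero.2 (hγ1 i (hsub hi))
  rw [← key]
  refine (sum_univ_ite_eq_zero_ite_le hk _ fun i => (1 - ρ i) * ∏ j ∈ (Finset.Icc 1 k).erase i,
    (1 - γ j - ρ j * (1 - γ i)) / (γ i - γ j)).trans ?_
  congr! 5 <;> ring

lemma starDist_eq_add_nu {i : ℕ} (hρ : ρ i ≠ 1) :
    starDist r ρ γ i = ρ i • starDist r ρ γ (i - 1) + (1 - ρ i) • nu r ρ γ i := by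
  funext j
  simp only [Pi.add_apply, Pi.smul_apply, smul_eq_mul, nu,
    mul_div_cancel₀ _ (sub_ne_zero.2 hρ.symm), add_sub_cancel]

variable (ρ γ) in
lemma nu_succ_apply_zero (i : ℕ) : nu r ρ γ (i + 1) 0 = 0 := by
  rw [nu, starDist_apply_zero, starDist_apply_zero, Finset.prod_Icc_succ_top i.succ_pos,
    Nat.add_sub_cancel, mul_comm, sub_self, zero_div]

lemma nu_mul_sub (hγ : Set.InjOn γ (Set.Icc 1 r)) (i : Fin r) (hρ : ρ (i + 1) ≠ 1)
    {j : Fin (r + 1)} (hj : j ≠ 0) :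
    nu r ρ γ (i + 1) j * (γ j - γ (i + 1)) = (1 - γ (i + 1)) * starDist r ρ γ i j := by
  have hρ' : 1 - ρ (i + 1) ≠ 0 := sub_ne_zero.2 hρ.symm
  rcases lt_trichotomy (j : ℕ) (i + 1) with hji | hji | hji
  · have hγ' : γ j - γ (i + 1) ≠ 0 :=
      sub_ne_zero.2 (hγ.ne (val_mem_Icc hj) (val_succ_mem_Icc i) hji.ne)
    rw [nu, starDist_succ ρ γ hj (by lia), Nat.add_sub_cancel]
    field_simp
    ring
  · rw [hji, sub_self, mul_zero, starDist_of_lt ρ γ (by lia), mul_zero]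
  · rw [nu, starDist_of_lt ρ γ hji, Nat.add_sub_cancel, starDist_of_lt ρ γ (by lia)]
    simp

lemma sum_nu (hγ : Set.InjOn γ (Set.Icc 1 r)) (hγ1 : ∀ i ∈ Set.Icc 1 r, γ i ≠ 1) {i : ℕ}
    (hi : i ≤ r) (hρ : ρ i ≠ 1) : ∑ j, nu r ρ γ i j = 1 := by
  simp only [nu]
  rw [← Finset.sum_div, Finset.sum_sub_distrib, ← Finset.mul_sum, sum_starDist hγ hγ1 hi,
    sum_starDist hγ hγ1 (by lia), mul_one, div_self (sub_ne_zero.2 hρ.symm)]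

variable (ρ γ)

lemma hatDist_zero : hatDist r ρ 0 = Pi.single 0 1 := by
  funext j
  rcases eq_or_ne j 0 with rfl | hj
  · simp [hatDist]
  · simp [hatDist, hj]

lemma hatDist_of_lt {k : ℕ} {j : Fin (r + 1)} (h : k < j) : hatDist r ρ k j = 0 := by
  rw [hatDist, if_neg (by lia), if_neg (by lia)]

lemma hatDist_succ (i : Fin r) : hatDist r ρ (i + 1) =
    ρ (i + 1) • hatDist r ρ i + (1 - ρ (i + 1)) • Pi.single i.succ 1 := by
  funext j
  simp only [Pi.add_apply, Pi.smul_apply, smul_eq_mul]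
  rcases lt_trichotomy j i.succ with hj | rfl | hj
  · have hj' : (j : ℕ) ≤ i := Nat.lt_succ_iff.1 hj
    rw [Pi.single_eq_of_ne hj.ne, hatDist, hatDist, if_pos (hj'.trans i.1.le_succ), if_pos hj',
      Finset.prod_Icc_succ_top i.1.succ_pos, Finset.prod_Icc_succ_top (by lia)]
    split_ifs <;> ring
  · rw [hatDist_of_lt ρ (k := i) i.1.lt_succ_self, hatDist]
    simp
  · have hj' : (i : ℕ) + 1 < j := hj
    rw [Pi.single_eq_of_ne hj.ne', hatDist_of_lt ρ hj',
      hatDist_of_lt ρ (i.1.lt_succ_self.trans hj')]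
    simp

lemma hatMatrix_zero : hatMatrix r ρ γ 0 = Pi.single 0 1 := by
  funext j
  rcases eq_or_ne j 0 with rfl | hj
  · simp [hatMatrix]
  · rw [hatMatrix, if_pos (Fin.pos_iff_ne_zero.2 hj), Pi.single_eq_of_ne hj]

lemma hatMatrix_succ (i : Fin r) : hatMatrix r ρ γ i.succ =
    (1 - γ (i + 1)) • hatDist r ρ i + γ (i + 1) • Pi.single i.succ 1 := by
  funext j
  simp only [Pi.add_apply, Pi.smul_apply, smul_eq_mul, hatMatrix]
  rcases lt_trichotomy j i.succ with hj | rfl | hj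
  · rw [if_neg hj.asymm, if_neg hj.ne, Pi.single_eq_of_ne hj.ne]
    simp
  · rw [if_neg (lt_irrefl _), if_pos rfl, if_neg i.succ_ne_zero, hatDist_of_lt ρ (by simp)]
    simp
  · rw [if_pos hj, Pi.single_eq_of_ne hj.ne', hatDist_of_lt ρ (i.1.lt_succ_self.trans hj)]
    simp

lemma absorb_zero {n : ℕ} (P : Matrix (Fin (n + 1)) (Fin (n + 1)) ℝ) :
    absorb P 0 = Pi.single 0 1 :=
  updateRow_self

lemma absorb_of_ne {n : ℕ} (P : Matrix (Fin (n + 1)) (Fin (n + 1)) ℝ) {i : Fin (n + 1)}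
    (hi : i ≠ 0) : absorb P i = P i :=
  updateRow_ne hi

lemma absorb_hatMatrix : absorb (hatMatrix r ρ γ) = hatMatrix r ρ γ := by
  rw [absorb, ← hatMatrix_zero ρ γ, updateRow_eq_self]

lemma absorb_starMatrix_of_ne {i : Fin (r + 1)} (hi : i ≠ 0) :
    absorb (starMatrix r ρ γ) i = γ i • Pi.single i 1 + (1 - γ i) • Pi.single 0 1 := by
  rw [absorb_of_ne _ hi]
  funext j
  simp only [starMatrix, if_neg hi, Pi.add_apply, Pi.smul_apply, smul_eq_mul, Pi.single_apply]
  grind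

lemma absorb_starMatrix_row_sum (i : Fin (r + 1)) : ∑ j, absorb (starMatrix r ρ γ) i j = 1 := by
  rcases eq_or_ne i 0 with rfl | hi
  · simp [absorb_zero]
  · simp [absorb_starMatrix_of_ne ρ γ hi, Finset.sum_add_distrib, ← Finset.mul_sum]

lemma vecMul_absorb_starMatrix_apply (v : Fin (r + 1) → ℝ) {j : Fin (r + 1)} (hj : j ≠ 0) :
    (v ᵥ* absorb (starMatrix r ρ γ)) j = v j * γ j := by
  rw [vecMul, dotProduct, Finset.sum_eq_single_of_mem j (Finset.mem_univ j)]
  · simp [absorb_starMatrix_of_ne ρ γ hj, hj]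
  · intro i _ hij
    rcases eq_or_ne i 0 with rfl | hi
    · simp [absorb_zero, hj]
    · simp [absorb_starMatrix_of_ne ρ γ hi, hj, hij.symm]

variable {ρ γ}

lemma hatDist_mem_stdSimplex (hρ : ∀ i ∈ Set.Icc 1 r, ρ i ∈ Set.Icc 0 1) {k : ℕ} (hk : k ≤ r) :
    hatDist r ρ k ∈ stdSimplex ℝ (Fin (r + 1)) := by
  induction k with
  | zero => exact hatDist_zero ρ ▸ single_mem_stdSimplex ℝ 0
  | succ k ih =>
    have := hρ (k + 1) (val_succ_mem_Icc ⟨k, hk⟩)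
    rw [hatDist_succ ρ ⟨k, hk⟩]
    exact convex_stdSimplex ℝ _ (ih (by lia)) (single_mem_stdSimplex ℝ _) this.1
      (sub_nonneg.2 this.2) (add_sub_cancel _ _)

lemma hatMatrix_mem_rowStochastic (hρ : ∀ i ∈ Set.Icc 1 r, ρ i ∈ Set.Icc 0 1)
    (hγ : ∀ i ∈ Set.Icc 1 r, γ i ∈ Set.Icc 0 1) :
    hatMatrix r ρ γ ∈ rowStochastic ℝ (Fin (r + 1)) := by
  have hrow (i) : hatMatrix r ρ γ i ∈ stdSimplex ℝ (Fin (r + 1)) := by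
    refine Fin.cases (hatMatrix_zero ρ γ ▸ single_mem_stdSimplex ℝ 0) (fun i => ?_) i
    have := hγ _ (val_succ_mem_Icc i)
    rw [hatMatrix_succ]
    exact convex_stdSimplex ℝ _ (hatDist_mem_stdSimplex hρ i.is_lt.le) (single_mem_stdSimplex ℝ _)
      (sub_nonneg.2 this.2) this.1 (sub_add_cancel _ _)
  exact mem_rowStochastic_iff_sum.2 ⟨fun i => (hrow i).1, fun i => (hrow i).2⟩

variable (ρ γ) in
lemma linkTwo_zero : linkTwo r ρ γ 0 = Pi.single 0 1 :=
  if_pos rfl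

variable (ρ γ) in
lemma linkTwo_succ (i : Fin r) : linkTwo r ρ γ i.succ = nu r ρ γ (i + 1) :=
  if_neg i.succ_ne_zero

lemma matchesZero_linkTwo : MatchesZero (linkTwo r ρ γ) := by
  refine Fin.cases ?_ fun i => ?_
  · simp [linkTwo_zero]
  · rw [linkTwo_succ, nu_succ_apply_zero, if_neg i.succ_ne_zero]

lemma hatDist_vecMul_linkTwo (hρ : ∀ i ∈ Set.Icc 1 r, ρ i ≠ 1) {k : ℕ} (hk : k ≤ r) :
    hatDist r ρ k ᵥ* linkTwo r ρ γ = starDist r ρ γ k := by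
  induction k with
  | zero =>
    rw [hatDist_zero, starDist_zero, single_one_vecMul]
    exact linkTwo_zero ρ γ
  | succ k ih =>
    rw [hatDist_succ ρ ⟨k, hk⟩, starDist_eq_add_nu (hρ _ (val_succ_mem_Icc ⟨k, hk⟩)), add_vecMul,
      smul_vecMul, smul_vecMul, ih (by lia), single_one_vecMul, row, linkTwo_succ,
      Nat.add_sub_cancel]

lemma nu_vecMul_absorb_starMatrix (hγ : Set.InjOn γ (Set.Icc 1 r))
    (hγ1 : ∀ i ∈ Set.Icc 1 r, γ i ≠ 1) (i : Fin r) (hρ : ρ (i + 1) ≠ 1) :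
    nu r ρ γ (i + 1) ᵥ* absorb (starMatrix r ρ γ) =
      (1 - γ (i + 1)) • starDist r ρ γ i + γ (i + 1) • nu r ρ γ (i + 1) := by
  refine eq_of_sum_eq_of_forall_ne ?_ 0 fun j hj => ?_
  · simp [sum_vecMul_of_row_sum (absorb_starMatrix_row_sum ρ γ), Finset.sum_add_distrib,
      ← Finset.mul_sum, sum_nu hγ hγ1 i.is_lt hρ, sum_starDist hγ hγ1 i.is_lt.le]
  · rw [vecMul_absorb_starMatrix_apply ρ γ _ hj]
    simp only [Pi.add_apply, Pi.smul_apply, smul_eq_mul]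
    linear_combination nu_mul_sub hγ i hρ hj

lemma linkTwo_mul_absorb_starMatrix (hγ : Set.InjOn γ (Set.Icc 1 r))
    (hγ1 : ∀ i ∈ Set.Icc 1 r, γ i ≠ 1) (hρ : ∀ i ∈ Set.Icc 1 r, ρ i ≠ 1) :
    linkTwo r ρ γ * absorb (starMatrix r ρ γ) = hatMatrix r ρ γ * linkTwo r ρ γ := by
  funext i
  rw [mul_apply_eq_vecMul, mul_apply_eq_vecMul]
  refine Fin.cases ?_ (fun i => ?_) i
  · rw [linkTwo_zero, hatMatrix_zero, single_one_vecMul, single_one_vecMul, row, row, linkTwo_zero,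
      absorb_zero]
  · rw [linkTwo_succ, nu_vecMul_absorb_starMatrix hγ hγ1 i (hρ _ (val_succ_mem_Icc i)),
      hatMatrix_succ, add_vecMul, smul_vecMul, smul_vecMul, hatDist_vecMul_linkTwo hρ i.is_lt.le,
      single_one_vecMul, row, linkTwo_succ]

lemma isQuasiIntertwining_linkTwo (hγ : Set.InjOn γ (Set.Icc 1 r))
    (hγ1 : ∀ i ∈ Set.Icc 1 r, γ i ≠ 1) (hρ : ∀ i ∈ Set.Icc 1 r, ρ i ≠ 1) :
    IsQuasiIntertwining (linkTwo r ρ γ) (starDist r ρ γ r) (absorb (starMatrix r ρ γ))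
      (hatDist r ρ r) (hatMatrix r ρ γ) where
  row_sum := by
    refine Fin.cases ?_ fun i => ?_
    · simp [linkTwo_zero]
    · rw [linkTwo_succ, sum_nu hγ hγ1 i.is_lt (hρ _ (val_succ_mem_Icc i))]
  intertwine := linkTwo_mul_absorb_starMatrix hγ hγ1 hρ
  initial := (hatDist_vecMul_linkTwo hρ le_rfl).symm

end StarAndDownward

/-! ### Quasi-intertwinings and absorption probabilities -/

section Intertwining

variable {l m n : ℕ}

lemma pow_intertwine {R ι κ : Type*} [CommSemiring R] [Fintype ι] [Fintype κ] [DecidableEq ι]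
    [DecidableEq κ] {Λ : Matrix ι κ R} {P : Matrix κ κ R} {Q : Matrix ι ι R}
    (h : Λ * P = Q * Λ) (t : ℕ) : Λ * P ^ t = Q ^ t * Λ := by
  induction t with
  | zero => simp
  | succ t ih =>
    rw [pow_succ, ← Matrix.mul_assoc, ih, Matrix.mul_assoc, h, ← Matrix.mul_assoc, ← pow_succ]

lemma matchesZero_iff {Λ : Matrix (Fin (m + 1)) (Fin (n + 1)) ℝ} :
    MatchesZero Λ ↔ Λ *ᵥ Pi.single 0 1 = Pi.single 0 1 := by
  simp [MatchesZero, funext_iff, Pi.single_apply]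

lemma MatchesZero.mul {Λ₁ : Matrix (Fin (m + 1)) (Fin (n + 1)) ℝ}
    {Λ₂ : Matrix (Fin (l + 1)) (Fin (m + 1)) ℝ} (h₂ : MatchesZero Λ₂) (h₁ : MatchesZero Λ₁) :
    MatchesZero (Λ₂ * Λ₁) := by
  rw [matchesZero_iff] at *
  rw [← mulVec_mulVec, h₁, h₂]

lemma MatchesZero.vecMul_apply_zero {Λ : Matrix (Fin (m + 1)) (Fin (n + 1)) ℝ}
    (h : MatchesZero Λ) (v : Fin (m + 1) → ℝ) : (v ᵥ* Λ) 0 = v 0 := by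
  simp [vecMul, dotProduct, h _]

lemma IsQuasiIntertwining.mul {Λ₁ : Matrix (Fin m) (Fin n) ℝ} {Λ₂ : Matrix (Fin l) (Fin m) ℝ}
    {π : Fin n → ℝ} {P : Matrix (Fin n) (Fin n) ℝ} {π' : Fin m → ℝ}
    {P' : Matrix (Fin m) (Fin m) ℝ} {π'' : Fin l → ℝ} {P'' : Matrix (Fin l) (Fin l) ℝ}
    (h₂ : IsQuasiIntertwining Λ₂ π' P' π'' P'') (h₁ : IsQuasiIntertwining Λ₁ π P π' P') :
    IsQuasiIntertwining (Λ₂ * Λ₁) π P π'' P'' where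
  row_sum i := by rw [mul_apply_eq_vecMul, sum_vecMul_of_row_sum h₁.row_sum, h₂.row_sum]
  intertwine := by
    rw [Matrix.mul_assoc, h₁.intertwine, ← Matrix.mul_assoc, h₂.intertwine, Matrix.mul_assoc]
  initial := by rw [h₁.initial, h₂.initial, vecMul_vecMul]

lemma IsQuasiIntertwining.vecMul_pow_apply_zero {Λ : Matrix (Fin (m + 1)) (Fin (n + 1)) ℝ}
    {π : Fin (n + 1) → ℝ} {P : Matrix (Fin (n + 1)) (Fin (n + 1)) ℝ} {π' : Fin (m + 1) → ℝ}
    {P' : Matrix (Fin (m + 1)) (Fin (m + 1)) ℝ} (h : IsQuasiIntertwining Λ π P π' P')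
    (h0 : MatchesZero Λ) (t : ℕ) : (π ᵥ* P ^ t) 0 = (π' ᵥ* P' ^ t) 0 := by
  rw [h.initial, vecMul_vecMul, pow_intertwine h.intertwine, ← vecMul_vecMul, h0.vecMul_apply_zero]

end Intertwining

/-! ### Strict interlacing -/

/-- The strict interlacing `1 = λ₀ > γ₁ > λ₁ > ⋯ > γ_r > λ_r`. -/
structure StrictlyInterlaced (r : ℕ) (lam γ : ℕ → ℝ) : Prop where
  lam_zero : lam 0 = 1
  lam_lt : ∀ i ∈ Set.Icc 1 r, lam i < γ i
  lt_lam : ∀ i ∈ Set.Icc 1 r, γ i < lam (i - 1)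

namespace StrictlyInterlaced

variable {r : ℕ} {lam γ ρ : ℕ → ℝ} (h : StrictlyInterlaced r lam γ)
include h

lemma lam_strictAntiOn : StrictAntiOn lam (Set.Icc 0 r) := by
  refine strictAntiOn_of_succ_lt Set.ordConnected_Icc fun i _ _ hi => ?_
  have hi' : i + 1 ∈ Set.Icc 1 r := ⟨Nat.le_add_left _ _, hi.2⟩
  exact (h.lam_lt _ hi').trans (h.lt_lam _ hi')

lemma gam_lt_lam {i j : ℕ} (hij : i < j) (hj : j ≤ r) : γ j < lam i :=
  (h.lt_lam j ⟨by lia, hj⟩).trans_le <|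
    h.lam_strictAntiOn.antitoneOn ⟨i.zero_le, by lia⟩ ⟨Nat.zero_le _, by lia⟩ (by lia)

lemma gam_strictAntiOn : StrictAntiOn γ (Set.Icc 1 r) := fun i hi _ hj hij =>
  (h.gam_lt_lam hij hj.2).trans (h.lam_lt i hi)

lemma gam_lt_one (i : ℕ) (hi : i ∈ Set.Icc 1 r) : γ i < 1 :=
  h.lam_zero ▸ h.gam_lt_lam hi.1 hi.2

lemma lam_lt_one (i : ℕ) (hi : i ∈ Set.Icc 1 r) : lam i < 1 :=
  (h.lam_lt i hi).trans (h.gam_lt_one i hi)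

lemma gam_pos (h0 : 0 ≤ lam r) (i : ℕ) (hi : i ∈ Set.Icc 1 r) : 0 < γ i :=
  (h0.trans (h.lam_strictAntiOn.antitoneOn ⟨i.zero_le, hi.2⟩ ⟨r.zero_le, le_rfl⟩ hi.2)).trans_lt
    (h.lam_lt i hi)

section Ratio

variable (hρ : ∀ i, ρ i = (1 - γ i) / (1 - lam i))
include hρ

lemma rho_mul (i : ℕ) (hi : i ∈ Set.Icc 1 r) : ρ i * (1 - lam i) = 1 - γ i := by
  rw [hρ, div_mul_cancel₀ _ (sub_ne_zero.2 (h.lam_lt_one i hi).ne')]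

lemma rho_pos (i : ℕ) (hi : i ∈ Set.Icc 1 r) : 0 < ρ i :=
  hρ i ▸ div_pos (sub_pos.2 (h.gam_lt_one i hi)) (sub_pos.2 (h.lam_lt_one i hi))

lemma rho_lt_one (i : ℕ) (hi : i ∈ Set.Icc 1 r) : ρ i < 1 := by
  rw [hρ, div_lt_one (sub_pos.2 (h.lam_lt_one i hi))]
  exact sub_lt_sub_left (h.lam_lt i hi) 1

lemma rho_mem_Icc (i : ℕ) (hi : i ∈ Set.Icc 1 r) : ρ i ∈ Set.Icc 0 1 :=
  ⟨(h.rho_pos hρ i hi).le, (h.rho_lt_one hρ i hi).le⟩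

lemma one_sub_gam_sub (i : ℕ) (hi : i ∈ Set.Icc 1 r) (x : ℝ) :
    1 - γ i - ρ i * (1 - x) = ρ i * (x - lam i) := by
  linear_combination -h.rho_mul hρ i hi

lemma starDist_pos {k : ℕ} (hk : k ≤ r) {i : Fin (r + 1)} (hi : i ≠ 0) (hik : i ≤ k) :
    0 < starDist r ρ γ k i := by
  have hi' := val_mem_Icc hi
  rw [starDist, if_neg (Fin.val_ne_zero_iff.2 hi), if_pos hik]
  refine mul_pos (sub_pos.2 (h.rho_lt_one hρ i hi')) (Finset.prod_pos fun j hj => ?_)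
  obtain ⟨hji, hj1, hjk⟩ : j ≠ i ∧ 1 ≤ j ∧ j ≤ k := by simpa using hj
  have hj : j ∈ Set.Icc 1 r := ⟨hj1, hjk.trans hk⟩
  rw [h.one_sub_gam_sub hρ j hj, mul_div_assoc]
  refine mul_pos (h.rho_pos hρ j hj) ?_
  rcases hji.lt_or_gt with hlt | hlt
  · exact div_pos_of_neg_of_neg (sub_neg.2 (h.gam_lt_lam hlt hi'.2))
      (sub_neg.2 (h.gam_strictAntiOn hj hi' hlt))
  · have hγ := h.gam_strictAntiOn hi' hj hlt
    exact div_pos (sub_pos.2 ((h.lam_lt j hj).trans hγ)) (sub_pos.2 hγ)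

lemma nu_nonneg (i : Fin r) (j : Fin (r + 1)) : 0 ≤ nu r ρ γ (i + 1) j := by
  have hi := val_succ_mem_Icc i
  have hρi := h.rho_lt_one hρ _ hi
  rcases eq_or_ne j 0 with rfl | hj
  · rw [nu_succ_apply_zero]
  rcases lt_trichotomy (j : ℕ) (i + 1) with hji | hji | hji
  · have hstar := h.starDist_pos hρ i.is_lt.le hj (Nat.le_of_lt_succ hji)
    refine nonneg_of_mul_nonneg_left ?_
      (sub_pos.2 (h.gam_strictAntiOn (val_mem_Icc hj) hi hji))
    rw [nu_mul_sub h.gam_strictAntiOn.injOn i hρi.ne hj]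
    exact mul_nonneg (sub_nonneg.2 (h.gam_lt_one _ hi).le) hstar.le
  · rw [nu, Nat.add_sub_cancel, starDist_of_lt ρ γ (show (i : ℕ) < j by lia), mul_zero, sub_zero]
    exact div_nonneg (h.starDist_pos hρ hi.2 hj hji.le).le (sub_nonneg.2 hρi.le)
  · rw [nu, starDist_of_lt ρ γ hji, Nat.add_sub_cancel, starDist_of_lt ρ γ (by lia)]
    simp

lemma linkTwo_nonneg (i j : Fin (r + 1)) : 0 ≤ linkTwo r ρ γ i j := by
  refine Fin.cases ?_ (fun i => ?_) i
  · rw [linkTwo_zero]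
    exact (single_mem_stdSimplex ℝ 0).1 j
  · rw [linkTwo_succ]
    exact h.nu_nonneg hρ i j

lemma prod_one_sub_gam : ∏ i ∈ Finset.Icc 1 r, (1 - γ i) =
    (∏ i ∈ Finset.Icc 1 r, ρ i) * ∏ i ∈ Finset.Icc 1 r, (1 - lam i) := by
  rw [← Finset.prod_mul_distrib]
  exact Finset.prod_congr rfl fun i hi => (h.rho_mul hρ i (Finset.mem_Icc.1 hi)).symm

lemma starDist_mul_prod {i : Fin (r + 1)} (hi : i ≠ 0) :
    (1 - γ i) * starDist r ρ γ r i * ∏ j ∈ (Finset.Icc 1 r).erase (i : ℕ), (γ i - γ j) =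
      (∏ j ∈ Finset.Icc 1 r, ρ j) * ∏ j ∈ Finset.Icc 1 r, (γ i - lam j) := by
  have hi' := val_mem_Icc hi
  have hγ : ∏ j ∈ (Finset.Icc 1 r).erase (i : ℕ), (γ i - γ j) ≠ 0 :=
    Finset.prod_ne_zero_iff.2 fun j hj => sub_ne_zero.2 <| h.gam_strictAntiOn.injOn.ne hi'
      (Finset.mem_Icc.1 (Finset.mem_of_mem_erase hj)) (Finset.ne_of_mem_erase hj).symm
  have hfactor : ∏ j ∈ (Finset.Icc 1 r).erase (i : ℕ),
      (1 - γ j - ρ j * (1 - γ i)) = ∏ j ∈ (Finset.Icc 1 r).erase (i : ℕ), ρ j * (γ i - lam j) :=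
    Finset.prod_congr rfl fun j hj =>
      h.one_sub_gam_sub hρ j (Finset.mem_Icc.1 (Finset.mem_of_mem_erase hj)) _
  rw [starDist, if_neg (Fin.val_ne_zero_iff.2 hi), if_pos hi'.2, Finset.prod_div_distrib, hfactor,
    ← Finset.prod_mul_distrib, ← Finset.mul_prod_erase _ (fun j => ρ j * (γ i - lam j))
      (Finset.mem_Icc.2 hi')]
  field_simp
  linear_combination (∏ j ∈ (Finset.Icc 1 r).erase (i : ℕ), ρ j * (γ i - lam j)) *
    h.one_sub_gam_sub hρ i hi' (γ i)

end Ratio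

end StrictlyInterlaced

/-! ### Reversible irreducible chains -/

/-- `P` is the transition matrix of an irreducible, possibly periodic, chain that is reversible with
respect to the probability distribution `π`. -/
structure IsReversibleIrreducible {ι : Type*} [Fintype ι] [DecidableEq ι] (P : Matrix ι ι ℝ)
    (π : ι → ℝ) : Prop where
  stochastic : P ∈ rowStochastic ℝ ι
  irreducible : P.IsIrreducible
  distribution : π ∈ stdSimplex ℝ ι
  reversible : ∀ i j, π i * P i j = π j * P j i

lemma IsReversibleErgodic.isReversibleIrreducible {n : ℕ}
    {P : Matrix (Fin (n + 1)) (Fin (n + 1)) ℝ} {π : Fin (n + 1) → ℝ}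
    (hP : IsReversibleErgodic P π) : IsReversibleIrreducible P π :=
  ⟨hP.stochastic, hP.ergodic.isIrreducible, hP.distribution, hP.reversible⟩

section Irreducible

variable {ι : Type*} [Fintype ι] [DecidableEq ι] {P : Matrix ι ι ℝ}

/-- Comparing total masses, the inequality `g ≤ g P` is an equality. -/
lemma eq_zero_of_le_vecMul (hP : P ∈ rowStochastic ℝ ι) (hirr : P.IsIrreducible) {g : ι → ℝ}
    (h0 : 0 ≤ g) (hle : g ≤ g ᵥ* P) {i : ι} (hi : g i = 0) : g = 0 := by
  have hstat : g ᵥ* P = g := by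
    have := (Finset.sum_eq_sum_iff_of_le fun j _ => hle j).1
      (sum_vecMul_of_row_sum (sum_row_of_mem_rowStochastic hP) g).symm
    exact (funext fun j => this j (Finset.mem_univ j)).symm
  have hpow (k : ℕ) : g ᵥ* P ^ k = g := by
    induction k with
    | zero => simp
    | succ k ih => rw [pow_succ, ← vecMul_vecMul, ih, hstat]
  funext j
  obtain ⟨k, -, hk⟩ := (isIrreducible_iff_exists_pow_pos hirr.nonneg).1 hirr j i
  have hsum : ∑ l, g l * (P ^ k) l i = 0 := hi ▸ congrFun (hpow k) i
  have hterm := (Finset.sum_eq_zero_iff_of_nonneg fun l _ =>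
    mul_nonneg (h0 l) ((pow_mem hP k).1 l i)).1 hsum j (Finset.mem_univ j)
  exact (mul_eq_zero.1 hterm).resolve_right hk.ne'

variable {π : ι → ℝ}

lemma IsReversibleIrreducible.stationary (hP : IsReversibleIrreducible P π) : π ᵥ* P = π := by
  funext j
  simp only [vecMul, dotProduct, hP.reversible _ j]
  rw [← Finset.mul_sum, sum_row_of_mem_rowStochastic hP.stochastic, mul_one]

lemma IsReversibleIrreducible.pos (hP : IsReversibleIrreducible P π) (i : ι) : 0 < π i := by
  refine (hP.distribution.1 i).lt_of_ne' fun hi => ?_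
  have hzero := eq_zero_of_le_vecMul hP.stochastic hP.irreducible hP.distribution.1
    hP.stationary.ge hi
  have hsum := hP.distribution.2
  simp [hzero] at hsum

end Irreducible

/-! ### Eigenframes of the killed chain -/

section Lift

variable {n : ℕ}

/-- The extension of a vector `w` on the nonzero states to a vector `(-w 1ᵀ | w)` of total mass
zero. -/
def zeroSumLift : (Fin n → ℝ) →ₗ[ℝ] (Fin (n + 1) → ℝ) where
  toFun w := Fin.cons (-∑ m, w m) w
  map_add' v w := by
    funext i
    refine Fin.cases ?_ (fun m => ?_) i <;> simp [Finset.sum_add_distrib, add_comm]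
  map_smul' c w := by
    funext i
    refine Fin.cases ?_ (fun m => ?_) i <;> simp [← Finset.mul_sum]

lemma zeroSumLift_apply_zero (w : Fin n → ℝ) : zeroSumLift w 0 = -∑ m, w m := rfl

lemma zeroSumLift_apply_succ (w : Fin n → ℝ) (m : Fin n) : zeroSumLift w m.succ = w m := rfl

lemma sum_zeroSumLift (w : Fin n → ℝ) : ∑ i, zeroSumLift w i = 0 := by
  simp [Fin.sum_univ_succ, zeroSumLift_apply_zero, zeroSumLift_apply_succ]

lemma single_add_zeroSumLift_tail {π : Fin (n + 1) → ℝ} (hπ : ∑ i, π i = 1) :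
    Pi.single 0 1 + zeroSumLift (Fin.tail π) = π := by
  refine eq_of_sum_eq_of_forall_ne ?_ 0 fun j hj => ?_
  · simp [Finset.sum_add_distrib, sum_zeroSumLift, hπ]
  · obtain ⟨m, rfl⟩ := Fin.exists_succ_eq.2 hj
    simp [zeroSumLift_apply_succ, Fin.tail]

variable {P : Matrix (Fin (n + 1)) (Fin (n + 1)) ℝ}

lemma absorb_row_sum (hP : ∀ i, ∑ j, P i j = 1) (i : Fin (n + 1)) : ∑ j, absorb P i j = 1 := by
  rcases eq_or_ne i 0 with rfl | hi
  · simp [absorb_zero]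
  · rw [absorb_of_ne P hi, hP]

lemma zeroSumLift_vecMul_absorb (hP : ∀ i, ∑ j, P i j = 1) (w : Fin n → ℝ) :
    zeroSumLift w ᵥ* absorb P = zeroSumLift (w ᵥ* deleteZero P) := by
  refine eq_of_sum_eq_of_forall_ne ?_ 0 fun j hj => ?_
  · rw [sum_vecMul_of_row_sum (absorb_row_sum hP), sum_zeroSumLift, sum_zeroSumLift]
  · obtain ⟨m, rfl⟩ := Fin.exists_succ_eq.2 hj
    simp [vecMul, dotProduct, Fin.sum_univ_succ, absorb_zero, absorb_of_ne, zeroSumLift_apply_succ,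
      deleteZero]

end Lift

section Eigenframe

variable {n : ℕ} {P : Matrix (Fin (n + 1)) (Fin (n + 1)) ℝ} {π : Fin (n + 1) → ℝ}
  {U : Matrix (Fin n) (Fin n) ℝ} {η : Fin n → ℝ}

lemma exists_isEigenframe (hπ : ∀ m : Fin n, 0 < π m.succ)
    (hrev : ∀ i j, π i * P i j = π j * P j i) : ∃ U η, IsEigenframe P π U η := by
  have hA : (diagonal (fun m : Fin n => √(π m.succ)) * deleteZero P *
      diagonal (fun m : Fin n => (√(π m.succ))⁻¹)).IsHermitian := by
    refine IsHermitian.ext fun i j => ?_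
    simp only [mul_diagonal, diagonal_mul, deleteZero, submatrix_apply, star_trivial]
    have hi := Real.sqrt_pos.2 (hπ i)
    have hj := Real.sqrt_pos.2 (hπ j)
    field_simp
    rw [Real.sq_sqrt (hπ i).le, Real.sq_sqrt (hπ j).le]
    linarith [hrev i.succ j.succ]
  have horth := Unitary.coe_star_mul_self hA.eigenvectorUnitary
  have heigen := hA.conjStarAlgAut_star_eigenvectorUnitary
  rw [Unitary.conjStarAlgAut_star_apply] at heigen
  rw [star_eq_conjTranspose, conjTranspose_eq_transpose_of_trivial] at horth heigen
  exact ⟨(hA.eigenvectorUnitary : Matrix (Fin n) (Fin n) ℝ)ᵀ, hA.eigenvalues,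
    by rwa [transpose_transpose], by simpa [transpose_transpose] using heigen⟩

variable (π U η) in
/-- The component of `(π 1, …, π n)` in the left eigenspace for `x` of the killed chain, whose
matrix is `deleteZero P`. -/
def eigComponent (x : ℝ) : Fin n → ℝ :=
  ∑ k with η k = x, eigCoord π U k • eigRow π U k

variable (π U η) in
/-- The total mass of `eigComponent π U η x`, which vanishes only if that component does. -/
def eigMass (x : ℝ) : ℝ :=
  ∑ k with η k = x, eigCoord π U k ^ 2

lemma sum_eigRow (k : Fin n) : ∑ m, eigRow π U k m = eigCoord π U k :=
  Finset.sum_congr rfl fun _ _ => mul_comm _ _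

lemma mul_diagonal_row (k : Fin n) :
    (U * diagonal (fun m : Fin n => √(π m.succ))) k = eigRow π U k := by
  funext m
  exact mul_diagonal _ U k m

namespace IsEigenframe

variable (hU : IsEigenframe P π U η)
include hU

lemma transpose_mul : Uᵀ * U = 1 :=
  mul_eq_one_comm.1 hU.orthogonal

lemma eigRow_vecMul (hπ : ∀ m : Fin n, 0 < π m.succ) (k : Fin n) :
    eigRow π U k ᵥ* deleteZero P = η k • eigRow π U k := by
  have hD : diagonal (fun m : Fin n => (√(π m.succ))⁻¹) * diagonal (fun m : Fin n => √(π m.succ)) =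
      1 := by
    simp [diagonal_mul_diagonal, (Real.sqrt_pos.2 (hπ _)).ne']
  have hmul : U * diagonal (fun m : Fin n => √(π m.succ)) * deleteZero P =
      diagonal η * (U * diagonal (fun m : Fin n => √(π m.succ))) := by
    rw [← hU.eigen]
    simp only [Matrix.mul_assoc]
    rw [← Matrix.mul_assoc Uᵀ U, hU.transpose_mul, Matrix.one_mul, hD, Matrix.mul_one]
  have hrow := congrFun hmul k
  rw [mul_apply_eq_vecMul, mul_diagonal_row] at hrow
  rw [hrow]
  funext m
  rw [diagonal_mul, mul_diagonal_row]
  rfl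

lemma sum_eigCoord_smul_eigRow (hπ : ∀ m : Fin n, 0 < π m.succ) :
    ∑ k, eigCoord π U k • eigRow π U k = Fin.tail π := by
  have hcoord (k : Fin n) : eigCoord π U k = (U *ᵥ fun m => √(π m.succ)) k :=
    Finset.sum_congr rfl fun _ _ => mul_comm _ _
  funext m
  calc (∑ k, eigCoord π U k • eigRow π U k) m
      = ((U *ᵥ fun m => √(π m.succ)) ᵥ* U) m * √(π m.succ) := by
        simp only [Finset.sum_apply, Pi.smul_apply, smul_eq_mul, eigRow, vecMul, dotProduct,
          Finset.sum_mul, hcoord, mul_assoc]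
    _ = Fin.tail π m := by
        rw [← mulVec_transpose, mulVec_mulVec, hU.transpose_mul, one_mulVec]
        exact Real.mul_self_sqrt (hπ m).le

lemma sum_eigCoord_sq (hπ : ∀ m : Fin n, 0 < π m.succ) (hsum : ∑ i, π i = 1) :
    ∑ k, eigCoord π U k ^ 2 = 1 - π 0 := by
  have htail : ∑ m, Fin.tail π m = 1 - π 0 :=
    eq_sub_of_add_eq' ((Fin.sum_univ_succ π).symm.trans hsum)
  rw [← htail, ← hU.sum_eigCoord_smul_eigRow hπ]
  simp only [Finset.sum_apply, Pi.smul_apply, smul_eq_mul]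
  rw [Finset.sum_comm]
  simp only [← Finset.mul_sum, sum_eigRow, sq]

end IsEigenframe

end Eigenframe

section Components

variable {n : ℕ} {P : Matrix (Fin (n + 1)) (Fin (n + 1)) ℝ} {π : Fin (n + 1) → ℝ}
  {U : Matrix (Fin n) (Fin n) ℝ} {η : Fin n → ℝ} {x : ℝ}

lemma sum_eigComponent (x : ℝ) : ∑ m, eigComponent π U η x m = eigMass π U η x := by
  simp only [eigComponent, eigMass, Finset.sum_apply, Pi.smul_apply, smul_eq_mul]
  rw [Finset.sum_comm]
  simp only [← Finset.mul_sum, sum_eigRow, sq]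

lemma eigComponent_of_eigMass_eq_zero (hx : eigMass π U η x = 0) : eigComponent π U η x = 0 := by
  have hcoord := (Finset.sum_eq_zero_iff_of_nonneg fun k _ => sq_nonneg (eigCoord π U k)).1 hx
  exact Finset.sum_eq_zero fun k hk => by
    rw [(pow_eq_zero_iff two_ne_zero).1 (hcoord k hk), zero_smul]

lemma IsEigenframe.eigComponent_vecMul (hU : IsEigenframe P π U η)
    (hπ : ∀ m : Fin n, 0 < π m.succ) (x : ℝ) :
    eigComponent π U η x ᵥ* deleteZero P = x • eigComponent π U η x := by
  rw [eigComponent, Matrix.sum_vecMul, Finset.smul_sum]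
  refine Finset.sum_congr rfl fun k hk => ?_
  rw [smul_vecMul, hU.eigRow_vecMul hπ, (Finset.mem_filter.1 hk).2, smul_comm]

variable (π U η) in
/-- The eigenvalues of the killed chain that are seen from the stationary distribution. -/
def visibleSpec : Finset ℝ := {x ∈ Finset.univ.image η | eigMass π U η x ≠ 0}

lemma mem_visibleSpec : x ∈ visibleSpec π U η ↔ eigMass π U η x ≠ 0 := by
  refine ⟨fun h => (Finset.mem_filter.1 h).2, fun h => Finset.mem_filter.2 ⟨?_, h⟩⟩
  obtain ⟨k, hk, -⟩ := Finset.exists_ne_zero_of_sum_ne_zero h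
  exact Finset.mem_image.2 ⟨k, Finset.mem_univ k, (Finset.mem_filter.1 hk).2⟩

lemma sum_visibleSpec_fiber {M : Type*} [AddCommMonoid M] {f : Fin n → M}
    (hf : ∀ x, eigMass π U η x = 0 → ∑ k with η k = x, f k = 0) :
    ∑ x ∈ visibleSpec π U η, ∑ k with η k = x, f k = ∑ k, f k := by
  rw [visibleSpec, Finset.sum_filter_of_ne fun x _ => mt (hf x)]
  exact Finset.sum_fiberwise_of_maps_to (fun k _ => Finset.mem_image_of_mem η (Finset.mem_univ k)) f

lemma IsEigenframe.sum_visibleSpec_eigComponent (hU : IsEigenframe P π U η)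
    (hπ : ∀ m : Fin n, 0 < π m.succ) :
    ∑ x ∈ visibleSpec π U η, eigComponent π U η x = Fin.tail π :=
  (sum_visibleSpec_fiber fun _ => eigComponent_of_eigMass_eq_zero).trans
    (hU.sum_eigCoord_smul_eigRow hπ)

end Components

/-! ### The quasi-link to the star chain -/

section LinkOne

variable {n r : ℕ} {P : Matrix (Fin (n + 1)) (Fin (n + 1)) ℝ} {π : Fin (n + 1) → ℝ}
  {U : Matrix (Fin n) (Fin n) ℝ} {η : Fin n → ℝ} {ρ γ : ℕ → ℝ}

lemma linkOne_zero : linkOne r ρ γ π U η 0 = Pi.single 0 1 :=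
  if_pos rfl

lemma linkOne_of_ne {i : Fin (r + 1)} (hi : i ≠ 0) :
    linkOne r ρ γ π U η i =
      Pi.single 0 1 + (starDist r ρ γ r i)⁻¹ • zeroSumLift (eigComponent π U η (γ i)) := by
  rw [linkOne, if_neg hi, eigComponent, map_sum, Finset.smul_sum]
  refine congrArg _ (Finset.sum_congr rfl fun k _ => ?_)
  rw [map_smul, smul_smul, div_eq_inv_mul]
  rfl

lemma linkOne_row_sum (i : Fin (r + 1)) : ∑ j, linkOne r ρ γ π U η i j = 1 := by
  rcases eq_or_ne i 0 with rfl | hi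
  · simp [linkOne_zero]
  · simp [linkOne_of_ne hi, Finset.sum_add_distrib, ← Finset.mul_sum, sum_zeroSumLift]

lemma matchesZero_linkOne (hstar : ∀ i : Fin (r + 1), i ≠ 0 → starDist r ρ γ r i ≠ 0)
    (hmass : ∀ i : Fin (r + 1), i ≠ 0 → starDist r ρ γ r i = eigMass π U η (γ i)) :
    MatchesZero (linkOne r ρ γ π U η) := by
  intro i
  rcases eq_or_ne i 0 with rfl | hi
  · simp [linkOne_zero]
  · simp [linkOne_of_ne hi, hi, zeroSumLift_apply_zero, sum_eigComponent, ← hmass i hi,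
      hstar i hi]

lemma linkOne_mul_absorb (hP : ∀ i, ∑ j, P i j = 1) (hπ : ∀ m : Fin n, 0 < π m.succ)
    (hU : IsEigenframe P π U η) :
    linkOne r ρ γ π U η * absorb P = absorb (starMatrix r ρ γ) * linkOne r ρ γ π U η := by
  funext i
  rw [mul_apply_eq_vecMul, mul_apply_eq_vecMul]
  rcases eq_or_ne i 0 with rfl | hi
  · rw [linkOne_zero, absorb_zero, single_one_vecMul, single_one_vecMul]
    exact (absorb_zero P).trans linkOne_zero.symm
  · have hzero : (Pi.single 0 1 : Fin (n + 1) → ℝ) ᵥ* absorb P = Pi.single 0 1 :=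
      (single_one_vecMul _ _).trans (absorb_zero P)
    have hhub : (Pi.single 0 1 : Fin (r + 1) → ℝ) ᵥ* linkOne r ρ γ π U η = Pi.single 0 1 :=
      (single_one_vecMul _ _).trans linkOne_zero
    have hrow : (Pi.single i 1 : Fin (r + 1) → ℝ) ᵥ* linkOne r ρ γ π U η =
        linkOne r ρ γ π U η i :=
      single_one_vecMul _ _
    rw [absorb_starMatrix_of_ne ρ γ hi, add_vecMul, smul_vecMul, smul_vecMul, hrow, hhub,
      linkOne_of_ne hi, add_vecMul, smul_vecMul, hzero, zeroSumLift_vecMul_absorb hP,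
      hU.eigComponent_vecMul hπ, map_smul]
    module

lemma starDist_vecMul_linkOne (hπ : ∀ m : Fin n, 0 < π m.succ) (hπ1 : ∑ i, π i = 1)
    (hU : IsEigenframe P π U η) (hstar : ∀ i : Fin (r + 1), i ≠ 0 → starDist r ρ γ r i ≠ 0)
    (hsum : ∑ i, starDist r ρ γ r i = 1) (hγ : Set.InjOn γ (Set.Icc 1 r))
    (hspec : (Finset.Icc 1 r).image γ = visibleSpec π U η) :
    starDist r ρ γ r ᵥ* linkOne r ρ γ π U η = π := by
  have hrow (i : Fin r) : starDist r ρ γ r i.succ • linkOne r ρ γ π U η i.succ =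
      starDist r ρ γ r i.succ • Pi.single 0 1 +
        zeroSumLift (eigComponent π U η (γ ((i : ℕ) + 1))) := by
    rw [linkOne_of_ne i.succ_ne_zero, smul_add, smul_inv_smul₀ (hstar _ i.succ_ne_zero),
      Fin.val_succ]
  have htail : ∑ i : Fin r, eigComponent π U η (γ ((i : ℕ) + 1)) = Fin.tail π := by
    rw [← hU.sum_visibleSpec_eigComponent hπ, ← hspec, Finset.sum_image (by simpa using hγ),
      Fin.sum_univ_eq_sum_range (fun i => eigComponent π U η (γ (i + 1))), Finset.range_eq_Ico,
      Finset.sum_Ico_add' (fun i => eigComponent π U η (γ i)), zero_add]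
    rfl
  calc starDist r ρ γ r ᵥ* linkOne r ρ γ π U η
      = ∑ i, starDist r ρ γ r i • linkOne r ρ γ π U η i := vecMul_eq_sum _ _
    _ = (∑ i, starDist r ρ γ r i) • Pi.single 0 1 + zeroSumLift (Fin.tail π) := by
      rw [Fin.sum_univ_succ, linkOne_zero, Finset.sum_congr rfl fun i _ => hrow i,
        Finset.sum_add_distrib, ← map_sum, htail, Fin.sum_univ_succ, add_smul, Finset.sum_smul,
        add_assoc]
    _ = π := by rw [hsum, one_smul, single_add_zeroSumLift_tail hπ1]

end LinkOne

/-! ### Characteristic polynomials and the secular polynomial -/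

section Secular

variable {s : Finset ℝ} {p : ℝ} {a : ℝ → ℝ}

/-- The polynomial `∏ (X - x) · (p + ∑ a x / (X - x))`, product and sum over `x ∈ s`. -/
def secular (s : Finset ℝ) (p : ℝ) (a : ℝ → ℝ) : ℝ[X] :=
  C p * Lagrange.nodal s id + ∑ x ∈ s, C (a x) * Lagrange.nodal (s.erase x) id

lemma degree_sum_C_mul_nodal_erase_lt (s : Finset ℝ) (a : ℝ → ℝ) :
    (∑ x ∈ s, C (a x) * Lagrange.nodal (s.erase x) id).degree < s.card := by
  refine (degree_sum_le _ _).trans_lt ((Finset.sup_lt_iff (WithBot.bot_lt_coe _)).2 fun x hx => ?_)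
  calc (C (a x) * Lagrange.nodal (s.erase x) id).degree
      ≤ 0 + (Lagrange.nodal (s.erase x) id).degree := by
        rw [degree_mul]
        exact add_le_add_left degree_C_le _
    _ < s.card := by
        rw [zero_add, Lagrange.degree_nodal]
        exact_mod_cast Finset.card_erase_lt_of_mem hx

lemma degree_C_mul_nodal (hp : p ≠ 0) : (C p * Lagrange.nodal s id).degree = s.card := by
  rw [degree_C_mul hp, Lagrange.degree_nodal]

lemma natDegree_secular (hp : p ≠ 0) : (secular s p a).natDegree = s.card := by
  refine natDegree_eq_of_degree_eq_some ?_
  rw [secular, degree_add_eq_left_of_degree_lt, degree_C_mul_nodal hp]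
  exact (degree_sum_C_mul_nodal_erase_lt s a).trans_eq (degree_C_mul_nodal hp).symm

lemma leadingCoeff_secular (hp : p ≠ 0) : (secular s p a).leadingCoeff = p := by
  rw [secular, leadingCoeff_add_of_degree_lt', leadingCoeff_mul, leadingCoeff_C,
    Lagrange.nodal_monic.leadingCoeff, mul_one]
  exact (degree_sum_C_mul_nodal_erase_lt s a).trans_eq (degree_C_mul_nodal hp).symm

lemma eval_secular_of_notMem {z : ℝ} (hz : z ∉ s) :
    (secular s p a).eval z = (∏ x ∈ s, (z - x)) * (p + ∑ x ∈ s, a x / (z - x)) := by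
  simp only [secular, eval_add, eval_mul, eval_C, eval_finsetSum, Lagrange.eval_nodal, id]
  rw [mul_add, mul_comm p, Finset.mul_sum]
  congr 1
  refine Finset.sum_congr rfl fun x hx => ?_
  have := sub_ne_zero.2 (ne_of_mem_of_not_mem hx hz).symm
  rw [← Finset.mul_prod_erase _ _ hx]
  field_simp

lemma eval_secular_of_mem {x : ℝ} (hx : x ∈ s) :
    (secular s p a).eval x = a x * ∏ y ∈ s.erase x, (x - y) := by
  simp only [secular, eval_add, eval_mul, eval_C, eval_finsetSum, Lagrange.eval_nodal, id]
  rw [Finset.prod_eq_zero hx (sub_self x), mul_zero, zero_add, Finset.sum_eq_single_of_mem x hx]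
  intro y _ hyx
  rw [Finset.prod_eq_zero (Finset.mem_erase.2 ⟨hyx.symm, hx⟩) (sub_self x), mul_zero]

end Secular

section Charpoly

lemma apply_zero_mul_det {R : Type*} [CommRing R] {n : ℕ} {M : Matrix (Fin (n + 1)) (Fin (n + 1)) R}
    {x : Fin (n + 1) → R} {a : R} (h : x ᵥ* M = Pi.single 0 a) :
    x 0 * M.det = a * (M.submatrix Fin.succ Fin.succ).det := by
  have hadj := congrFun (congrArg (· ᵥ* M.adjugate) h) 0
  simp only [vecMul_vecMul, mul_adjugate, vecMul_smul, vecMul_one, single_vecMul, Pi.smul_apply,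
    smul_eq_mul, row_apply, adjugate_fin_succ_eq_det_submatrix] at hadj
  simpa [mul_comm] using hadj

variable {n : ℕ} {P : Matrix (Fin (n + 1)) (Fin (n + 1)) ℝ} {π : Fin (n + 1) → ℝ}
  {U : Matrix (Fin n) (Fin n) ℝ} {η : Fin n → ℝ}

lemma eq_zero_of_vecMul_deleteZero (hP : P ∈ rowStochastic ℝ (Fin (n + 1)))
    (hirr : P.IsIrreducible) {v : Fin n → ℝ} {x : ℝ} (hx : 1 ≤ x)
    (hv : v ᵥ* deleteZero P = x • v) : v = 0 := by
  have hle : (Fin.cons 0 |v| : Fin (n + 1) → ℝ) ≤ (Fin.cons 0 |v| : Fin (n + 1) → ℝ) ᵥ* P := by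
    intro i
    simp only [vecMul, dotProduct, Fin.sum_univ_succ, Fin.cons_zero, zero_mul, zero_add,
      Fin.cons_succ, Pi.abs_apply]
    refine Fin.cases ?_ (fun m => ?_) i
    · exact Finset.sum_nonneg fun l _ => mul_nonneg (abs_nonneg _) (hP.1 _ _)
    · calc |v m| ≤ |x| * |v m| :=
            le_mul_of_one_le_left (abs_nonneg _) (hx.trans (le_abs_self x))
        _ = |∑ l, v l * P l.succ m.succ| := by
            rw [← abs_mul]
            exact congrArg abs (congrFun hv m).symm
        _ ≤ ∑ l, |v l * P l.succ m.succ| := Finset.abs_sum_le_sum_abs _ _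
        _ = ∑ l, |v l| * P l.succ m.succ := by
            simp only [abs_mul, abs_of_nonneg (hP.1 _ _)]
  have hnonneg : (0 : Fin (n + 1) → ℝ) ≤ Fin.cons 0 |v| :=
    fun i => Fin.cases le_rfl (fun m => abs_nonneg (v m)) i
  have hzero := eq_zero_of_le_vecMul hP hirr hnonneg hle (i := 0) rfl
  exact funext fun m => abs_eq_zero.1 (congrFun hzero m.succ)

variable (π U η) in
/-- The row vector `(π 1, …, π n) (z - P₀)⁻¹`, expanded in the eigenframe. -/
def resolventRow (z : ℝ) : Fin n → ℝ :=
  ∑ k, (eigCoord π U k / (z - η k)) • eigRow π U k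

lemma sum_resolventRow (z : ℝ) :
    ∑ m, resolventRow π U η z m = ∑ k, eigCoord π U k ^ 2 / (z - η k) := by
  simp only [resolventRow, Finset.sum_apply, Pi.smul_apply, smul_eq_mul]
  rw [Finset.sum_comm]
  simp only [← Finset.mul_sum, sum_eigRow]
  simp only [sq, div_mul_eq_mul_div]

variable (hU : IsEigenframe P π U η)
include hU

lemma IsEigenframe.smul_resolventRow_sub (hπ : ∀ m : Fin n, 0 < π m.succ) {z : ℝ}
    (hz : ∀ k, z ≠ η k) :
    z • resolventRow π U η z - resolventRow π U η z ᵥ* deleteZero P = Fin.tail π := by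
  rw [← hU.sum_eigCoord_smul_eigRow hπ, resolventRow, Matrix.sum_vecMul, Finset.smul_sum,
    ← Finset.sum_sub_distrib]
  refine Finset.sum_congr rfl fun k _ => ?_
  rw [smul_vecMul, hU.eigRow_vecMul hπ, smul_comm _ (η k), ← sub_smul, smul_smul,
    mul_div_cancel₀ _ (sub_ne_zero.2 (hz k))]

variable (hP : IsReversibleIrreducible P π)
include hP

lemma IsEigenframe.sub_smul_cons_resolventRow_vecMul {z : ℝ} (hz : ∀ k, z ≠ η k) :
    (π - (z - 1) • Fin.cons 0 (resolventRow π U η z)) ᵥ* (scalar (Fin (n + 1)) z - P) =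
      Pi.single 0 ((z - 1) * (1 - (z - 1) * ∑ k, eigCoord π U k ^ 2 / (z - η k))) := by
  set q := resolventRow π U η z with hq
  set x : Fin (n + 1) → ℝ := π - (z - 1) • Fin.cons 0 q with hx
  have hxP : x ᵥ* (scalar (Fin (n + 1)) z - P) = z • x - x ᵥ* P := by
    rw [vecMul_sub, scalar_apply, ← smul_one_eq_diagonal, vecMul_smul, vecMul_one]
  rw [hxP]
  refine eq_of_sum_eq_of_forall_ne ?_ 0 fun j hj => ?_
  · have hsum : ∑ i, x i = 1 - (z - 1) * ∑ k, eigCoord π U k ^ 2 / (z - η k) := by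
      rw [← sum_resolventRow]
      simp [x, q, Finset.sum_sub_distrib, hP.distribution.2, Fin.sum_univ_succ (Fin.cons _ _),
        ← Finset.mul_sum]
    simp only [Pi.sub_apply, Pi.smul_apply, smul_eq_mul]
    rw [Finset.sum_sub_distrib, sum_vecMul_of_row_sum (sum_row_of_mem_rowStochastic hP.stochastic),
      ← Finset.mul_sum, hsum, Finset.sum_pi_single',
      if_pos (Finset.mem_univ _)]
    ring
  · obtain ⟨m, rfl⟩ := Fin.exists_succ_eq.2 hj
    have hres := congrFun (hU.smul_resolventRow_sub (fun m => hP.pos m.succ) hz) m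
    have hcons : ((Fin.cons 0 q : Fin (n + 1) → ℝ) ᵥ* P) m.succ = (q ᵥ* deleteZero P) m := by
      simp [vecMul, dotProduct, Fin.sum_univ_succ, deleteZero]
    rw [Pi.single_eq_of_ne hj]
    simp only [hx, sub_vecMul, smul_vecMul, hP.stationary, Pi.sub_apply, Pi.smul_apply, hcons,
      Fin.cons_succ, smul_eq_mul]
    simp only [← hq, Pi.sub_apply, Pi.smul_apply, smul_eq_mul, Fin.tail] at hres
    linear_combination (1 - z) * hres

lemma IsEigenframe.mul_eval_charpoly {z : ℝ} (hz : ∀ k, z ≠ η k) :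
    π 0 * P.charpoly.eval z = (z - 1) * (1 - (z - 1) * ∑ k, eigCoord π U k ^ 2 / (z - η k)) *
      (deleteZero P).charpoly.eval z := by
  have hdet := apply_zero_mul_det (hU.sub_smul_cons_resolventRow_vecMul hP hz)
  have hminor : (scalar (Fin (n + 1)) z - P).submatrix Fin.succ Fin.succ =
      scalar (Fin n) z - deleteZero P := by
    ext i j
    simp [deleteZero, diagonal_apply]
  rw [hminor] at hdet
  simpa [eval_charpoly] using hdet

lemma IsEigenframe.one_sub_mul_sum_div {z : ℝ} (hz : ∀ k, z ≠ η k) :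
    1 - (z - 1) * ∑ k, eigCoord π U k ^ 2 / (z - η k) =
      π 0 + ∑ x ∈ visibleSpec π U η, eigMass π U η x * (1 - x) / (z - x) := by
  have hfiber : ∑ x ∈ visibleSpec π U η, eigMass π U η x * (1 - x) / (z - x) =
      ∑ k, eigCoord π U k ^ 2 * (1 - η k) / (z - η k) := by
    have hmass (x : ℝ) : eigMass π U η x * (1 - x) / (z - x) =
        ∑ k with η k = x, eigCoord π U k ^ 2 * (1 - η k) / (z - η k) := by
      rw [eigMass, Finset.sum_mul, Finset.sum_div]
      exact Finset.sum_congr rfl fun k hk => by rw [(Finset.mem_filter.1 hk).2]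
    simp only [hmass]
    refine sum_visibleSpec_fiber fun x hx => ?_
    rw [← hmass, hx, zero_mul, zero_div]
  have hπ0 := hU.sum_eigCoord_sq (fun m => hP.pos m.succ) hP.distribution.2
  have hterm (k : Fin n) : (z - 1) * (eigCoord π U k ^ 2 / (z - η k)) =
      eigCoord π U k ^ 2 - eigCoord π U k ^ 2 * (1 - η k) / (z - η k) := by
    have := sub_ne_zero.2 (hz k)
    field_simp
    ring
  rw [hfiber, Finset.mul_sum, Finset.sum_congr rfl fun k _ => hterm k, Finset.sum_sub_distrib, hπ0]
  ring

end Charpoly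

section Visible

variable {n : ℕ} {P : Matrix (Fin (n + 1)) (Fin (n + 1)) ℝ} {π : Fin (n + 1) → ℝ}
  {U : Matrix (Fin n) (Fin n) ℝ} {η : Fin n → ℝ}

variable (π U η) in
/-- The polynomial whose roots are the reduced eigenvalues of the chain other than `1`. -/
def visibleSecular : ℝ[X] :=
  secular (visibleSpec π U η) (π 0) fun x => eigMass π U η x * (1 - x)

variable (hU : IsEigenframe P π U η) (hP : IsReversibleIrreducible P π)
include hU hP

lemma IsEigenframe.lt_one_of_mem_visibleSpec {x : ℝ} (hx : x ∈ visibleSpec π U η) : x < 1 := by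
  by_contra! h
  have hzero := eq_zero_of_vecMul_deleteZero hP.stochastic hP.irreducible h
    (hU.eigComponent_vecMul (fun m => hP.pos m.succ) x)
  refine mem_visibleSpec.1 hx ?_
  rw [← sum_eigComponent, hzero]
  exact Finset.sum_const_zero

lemma IsEigenframe.charpoly_mul_nodal :
    C (π 0) * (P.charpoly * Lagrange.nodal (visibleSpec π U η) id) =
      (deleteZero P).charpoly * ((X - C 1) * visibleSecular π U η) := by
  refine eq_of_infinite_eval_eq _ _ <|
    (Finset.univ.image η).finite_toSet.infinite_compl.mono fun z hz => ?_
  have hη (k : Fin n) : z ≠ η k := fun h =>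
    hz (by simp [h])
  have hvis : z ∉ visibleSpec π U η := fun h => hz (Finset.filter_subset _ _ h)
  simp only [Set.mem_ofPred_eq, eval_mul, eval_C, eval_sub, eval_X, Lagrange.eval_nodal, id]
  rw [visibleSecular, eval_secular_of_notMem hvis, ← hU.one_sub_mul_sum_div hP hη, ← mul_assoc,
    hU.mul_eval_charpoly hP hη]
  ring

end Visible

/-! ### Interlacing roots and sorted multisets -/

section Interlacing

variable {g : ℕ → ℝ} {G : ℝ[X]}

lemma neg_one_pow_mul_prod_sub_pos {m : ℕ} (hg : StrictAntiOn g (Set.Icc 1 m)) {i : ℕ}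
    (hi : i + 1 ∈ Set.Icc 1 m) :
    0 < (-1) ^ i * ∏ j ∈ (Finset.Icc 1 m).erase (i + 1), (g (i + 1) - g j) := by
  have hfilter : {j ∈ (Finset.Icc 1 m).erase (i + 1) | j < i + 1} = Finset.Ico 1 (i + 1) := by
    ext j
    simp only [Finset.mem_filter, Finset.mem_erase, Finset.mem_Icc, Finset.mem_Ico]
    grind
  have hpow : (-1 : ℝ) ^ i =
      ∏ j ∈ (Finset.Icc 1 m).erase (i + 1), if j < i + 1 then -1 else 1 := by
    rw [Finset.prod_ite, Finset.prod_const, Finset.prod_const_one, mul_one, hfilter, Nat.card_Ico,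
      Nat.add_sub_cancel]
  rw [hpow, ← Finset.prod_mul_distrib]
  refine Finset.prod_pos fun j hj => ?_
  obtain ⟨hji, hj⟩ := Finset.mem_erase.1 hj
  have hj : j ∈ Set.Icc 1 m := Finset.mem_Icc.1 hj
  split_ifs with hlt
  · linarith [hg hj hi hlt]
  · linarith [hg hi hj (by lia)]

lemma exists_lt_neg_one_pow_mul_eval_pos (hlead : 0 < G.leadingCoeff) (b : ℝ) :
    ∃ x < b, 0 < (-1) ^ G.natDegree * G.eval x := by
  rcases G.natDegree.eq_zero_or_pos with hdeg | hdeg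
  · rw [eq_C_of_natDegree_eq_zero hdeg, leadingCoeff_C] at hlead
    refine ⟨b - 1, sub_one_lt b, ?_⟩
    rw [eq_C_of_natDegree_eq_zero hdeg]
    simpa using hlead
  · have hH : (C ((-1) ^ G.natDegree) * G.comp (-X)).leadingCoeff = G.leadingCoeff := by
      rw [leadingCoeff_mul, leadingCoeff_C, leadingCoeff_comp (by simp), leadingCoeff_neg,
        leadingCoeff_X, mul_left_comm, ← mul_pow, neg_one_mul, neg_neg, one_pow, mul_one]
    have hHdeg : 0 < (C ((-1) ^ G.natDegree) * G.comp (-X)).degree := by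
      rw [← natDegree_pos_iff_degree_pos, natDegree_C_mul (by simp), natDegree_comp]
      simpa using hdeg
    obtain ⟨x, hxb, hx⟩ := ((tendsto_atTop_of_leadingCoeff_nonneg _ hHdeg
      (hH ▸ hlead.le)).eventually_gt_atTop 0 |>.and (Filter.eventually_gt_atTop (-b))).exists
    refine ⟨-x, neg_lt.1 hx, ?_⟩
    simpa using hxb

lemma exists_roots_eq_map_of_alternating {m : ℕ} (hdeg : G.natDegree = m) (hG : G ≠ 0)
    (hg : StrictAntiOn g (Set.Iic m)) (hsign : ∀ i ≤ m, 0 < (-1) ^ i * G.eval (g i)) :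
    ∃ l : ℕ → ℝ, (∀ i < m, l i ∈ Set.Ioo (g (i + 1)) (g i)) ∧
      G.roots = (Multiset.range m).map l := by
  have hroot (i : ℕ) (hi : i < m) : ∃ x ∈ Set.Ioo (g (i + 1)) (g i), G.eval x = 0 := by
    have hneg := hsign (i + 1) hi
    rw [pow_succ, mul_neg_one, neg_mul, neg_pos] at hneg
    obtain ⟨x, hx, hx0⟩ := intermediate_value_Ioo
      (hg (Set.mem_Iic.2 hi.le) (Set.mem_Iic.2 hi) i.lt_succ_self).le
      (continuous_const.mul G.continuous).continuousOn ⟨hneg, hsign i hi.le⟩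
    exact ⟨x, hx, (mul_eq_zero.1 hx0).resolve_left (pow_ne_zero _ (by norm_num))⟩
  choose! l hl hl0 using hroot
  have hanti : StrictAntiOn l (Set.Iio m) := by
    refine strictAntiOn_of_succ_lt Set.ordConnected_Iio fun i _ hi hi' => ?_
    exact (hl (i + 1) hi').2.trans (hl i hi).1
  have hnodup : ((Multiset.range m).map l).Nodup :=
    (Multiset.nodup_range m).map_on fun i hi j hj =>
      hanti.injOn (Multiset.mem_range.1 hi) (Multiset.mem_range.1 hj)
  refine ⟨l, hl, (Multiset.eq_of_le_of_card_le ?_ ?_).symm⟩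
  · refine (Multiset.le_iff_subset hnodup).2 fun x hx => ?_
    obtain ⟨i, hi, rfl⟩ := Multiset.mem_map.1 hx
    exact (mem_roots hG).2 (hl0 i (Multiset.mem_range.1 hi))
  · simpa [hdeg] using G.card_roots'

lemma exists_strictlyInterlaced_roots {r : ℕ} (hdeg : G.natDegree = r) (hlead : 0 < G.leadingCoeff)
    (hg : StrictAntiOn g (Set.Icc 1 r)) (hg1 : ∀ i ∈ Set.Icc 1 r, g i < 1)
    (hsign : ∀ i ∈ Set.Icc 1 r, 0 < G.eval (g i) * ∏ j ∈ (Finset.Icc 1 r).erase i, (g i - g j)) :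
    ∃ lam : ℕ → ℝ, StrictlyInterlaced r lam g ∧
      G.roots = (Multiset.range r).map fun i => lam (i + 1) := by
  obtain ⟨b, hb, hb0⟩ := exists_lt_neg_one_pow_mul_eval_pos hlead (g r)
  set f : ℕ → ℝ := fun i => if i < r then g (i + 1) else b with hf
  have hf_lt (i : ℕ) (hi : i < r) : f i = g (i + 1) := if_pos hi
  have hanti : StrictAntiOn f (Set.Iic r) := by
    refine strictAntiOn_of_succ_lt Set.ordConnected_Iic fun i _ _ hi => ?_
    rw [Order.succ_eq_add_one] at hi ⊢
    rw [hf_lt i hi]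
    rcases (show i + 1 ≤ r from hi).lt_or_eq with h | h
    · rw [hf_lt _ h]
      exact hg ⟨i.succ_pos, h.le⟩ ⟨(i + 1).succ_pos, h⟩ (i + 1).lt_succ_self
    · simpa [hf, h] using hb
  have halt (i : ℕ) (hi : i ≤ r) : 0 < (-1) ^ i * G.eval (f i) := by
    rcases hi.lt_or_eq with h | rfl
    · have hi : i + 1 ∈ Set.Icc 1 r := ⟨i.succ_pos, h⟩
      have hprod := mul_pos (hsign _ hi) (neg_one_pow_mul_prod_sub_pos hg hi)
      rw [hf_lt i h]
      refine pos_of_mul_pos_left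
        (b := (∏ j ∈ (Finset.Icc 1 r).erase (i + 1), (g (i + 1) - g j)) ^ 2) ?_ (sq_nonneg _)
      convert hprod using 1
      ring
    · simpa [hf, hdeg] using hb0
  obtain ⟨l, hl, hroots⟩ := exists_roots_eq_map_of_alternating hdeg
    (leadingCoeff_ne_zero.1 hlead.ne') hanti halt
  refine ⟨fun i => if i = 0 then 1 else l (i - 1), ⟨if_pos rfl, fun i hi => ?_, fun i hi => ?_⟩,
    by simpa using hroots⟩
  · obtain ⟨i, rfl⟩ := Nat.exists_eq_add_of_le' hi.1
    exact hf_lt i hi.2 ▸ (hl i hi.2).2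
  · obtain ⟨_ | i, rfl⟩ := Nat.exists_eq_add_of_le' hi.1
    · exact hg1 _ hi
    · exact hf_lt (i + 1) hi.2 ▸ (hl i (i.lt_succ_self.trans hi.2)).1

end Interlacing

section SortedMultiset

variable {α : Type*}

lemma sub_inter_of_add_eq_add [DecidableEq α] {s t a b : Multiset α} (h : s + a = t + b)
    (hd : Disjoint a b) : t - s ∩ t = a ∧ s - s ∩ t = b := by
  have hcount (x : α) : s.count x + a.count x = t.count x + b.count x := by
    rw [← Multiset.count_add, h, Multiset.count_add]
  have hdisj (x : α) : a.count x = 0 ∨ b.count x = 0 := by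
    simp only [Multiset.count_eq_zero]
    exact not_and_or.1 fun hx => Multiset.disjoint_left.1 hd hx.1 hx.2
  constructor <;>
  · ext x
    rw [Multiset.count_sub, Multiset.count_inter]
    grind

variable [LinearOrder α] (d : α)

lemma map_range_getD_sort (s : Multiset α) :
    (Multiset.range s.card).map (fun i => (s.sort (· ≥ ·)).getD i d) = s := by
  conv_rhs => rw [← Multiset.sort_eq s (· ≥ ·)]
  refine congrArg _ (List.ext_getElem (by simp) fun i _ hi => ?_)
  simp [List.getElem?_eq_getElem hi]

lemma strictAntiOn_getD_sort {s : Multiset α} (hs : s.Nodup) :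
    StrictAntiOn (fun i => (s.sort (· ≥ ·)).getD i d) (Set.Iio s.card) := by
  intro i hi j hj hij
  rw [Set.mem_Iio, ← Multiset.length_sort (r := (· ≥ ·))] at hi hj
  have hnodup : (s.sort (· ≥ ·)).Nodup := by rwa [← Multiset.coe_nodup, Multiset.sort_eq]
  simp only [List.getD_eq_getElem _ _ hi, List.getD_eq_getElem _ _ hj]
  refine (List.pairwise_iff_getElem.1 (Multiset.pairwise_sort s (· ≥ ·)) i j hi hj hij).lt_of_ne
    fun h => hij.ne' (hnodup.getElem_inj_iff.1 h)

lemma getD_sort_map_range {m : ℕ} {f : ℕ → α} (hf : StrictAntiOn f (Set.Iio m)) {i : ℕ}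
    (hi : i < m) : (((Multiset.range m).map f).sort (· ≥ ·)).getD i d = f i := by
  have hsort : ((Multiset.range m).map f).sort (· ≥ ·) = (List.range m).map f := by
    refine List.Perm.eq_of_pairwise' (r := (· ≥ ·)) (Multiset.pairwise_sort _ _) ?_ ?_
    · refine List.pairwise_map.2 (List.pairwise_lt_range.imp_of_mem fun hi hj hij => ?_)
      exact (hf (List.mem_range.1 hi) (List.mem_range.1 hj) hij).le
    · rw [← Multiset.coe_eq_coe, Multiset.sort_eq]
      rfl
  rw [hsort, List.getD_eq_getElem _ _ (by simpa using hi), List.getElem_map, List.getElem_range]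

end SortedMultiset

/-! ### The reduced spectra -/

section ReducedSpec

lemma prod_erase_image {α β M : Type*} [DecidableEq α] [DecidableEq β] [CommMonoid M]
    {s : Finset α} {g : α → β} (hg : Set.InjOn g s) {i : α} (hi : i ∈ s) (f : β → M) :
    ∏ y ∈ (s.image g).erase (g i), f y = ∏ j ∈ s.erase i, f (g j) := by
  have himage : (s.image g).erase (g i) = (s.erase i).image g := by
    ext y
    simp only [Finset.mem_erase, Finset.mem_image]
    exact ⟨fun ⟨hy, j, hj, hjy⟩ => ⟨j, ⟨fun h => hy (h ▸ hjy.symm), hj⟩, hjy⟩,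
      fun ⟨j, ⟨hji, hj⟩, hjy⟩ => ⟨hjy ▸ hg.ne hj hi hji, j, hj, hjy⟩⟩
  rw [himage, Finset.prod_image (hg.mono (Finset.erase_subset i s))]

lemma val_Icc_one_map {α : Type*} (r : ℕ) (f : ℕ → α) :
    (Finset.Icc 1 r).val.map f = (Multiset.range r).map fun i => f (i + 1) := by
  have hshift : Finset.Icc 1 r = (Finset.range r).map (addRightEmbedding 1) := by
    rw [Finset.range_eq_Ico, Finset.map_add_right_Ico, zero_add]
    rfl
  rw [hshift, Finset.map_val, Multiset.map_map]
  rfl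

namespace IsEigenframe

variable {n : ℕ} {P : Matrix (Fin (n + 1)) (Fin (n + 1)) ℝ} {π : Fin (n + 1) → ℝ}
  {U : Matrix (Fin n) (Fin n) ℝ} {η : Fin n → ℝ}
  (hU : IsEigenframe P π U η) (hP : IsReversibleIrreducible P π)

include hP in
lemma leadingCoeff_visibleSecular : (visibleSecular π U η).leadingCoeff = π 0 :=
  leadingCoeff_secular (hP.pos 0).ne'

include hP in
lemma visibleSecular_ne_zero : visibleSecular π U η ≠ 0 :=
  leadingCoeff_ne_zero.1 (leadingCoeff_visibleSecular hP ▸ (hP.pos 0).ne')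

include hU hP

lemma spec_add_visibleSpec :
    spec P + (visibleSpec π U η).val =
      spec (deleteZero P) + 1 ::ₘ (visibleSecular π U η).roots := by
  have hne : (X - C 1) * visibleSecular π U η ≠ 0 :=
    mul_ne_zero (X_sub_C_ne_zero 1) (visibleSecular_ne_zero hP)
  have hroots := congrArg roots (hU.charpoly_mul_nodal hP)
  rw [roots_C_mul _ (hP.pos 0).ne',
    roots_mul (mul_ne_zero (charpoly_monic P).ne_zero Lagrange.nodal_monic.ne_zero),
    roots_mul (mul_ne_zero (charpoly_monic _).ne_zero hne), roots_mul hne, roots_X_sub_C,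
    Multiset.singleton_add, Lagrange.nodal_eq] at hroots
  simp only [id, roots_prod_X_sub_C] at hroots
  exact hroots

lemma eval_visibleSecular_ne_zero {x : ℝ} (hx : x ∈ visibleSpec π U η) :
    (visibleSecular π U η).eval x ≠ 0 := by
  rw [visibleSecular, eval_secular_of_mem hx]
  refine mul_ne_zero (mul_ne_zero (mem_visibleSpec.1 hx)
    (sub_pos.2 (hU.lt_one_of_mem_visibleSpec hP hx)).ne') ?_
  exact Finset.prod_ne_zero_iff.2 fun y hy => sub_ne_zero.2 (Finset.ne_of_mem_erase hy).symm

lemma disjoint_visibleSpec :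
    Disjoint (visibleSpec π U η).val (1 ::ₘ (visibleSecular π U η).roots) := by
  refine Multiset.disjoint_left.2 fun {x} hx hroot => ?_
  rcases Multiset.mem_cons.1 hroot with rfl | hroot
  · exact (hU.lt_one_of_mem_visibleSpec hP hx).false
  · exact hU.eval_visibleSecular_ne_zero hP hx (isRoot_of_mem_roots hroot)

lemma reducedSpecZero_eq : reducedSpecZero P = (visibleSpec π U η).val :=
  (sub_inter_of_add_eq_add (hU.spec_add_visibleSpec hP) (hU.disjoint_visibleSpec hP)).1

lemma reducedSpec_eq : reducedSpec P = 1 ::ₘ (visibleSecular π U η).roots :=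
  (sub_inter_of_add_eq_add (hU.spec_add_visibleSpec hP) (hU.disjoint_visibleSpec hP)).2

lemma card_visibleSpec : (visibleSpec π U η).card = reducedCard P := by
  rw [reducedCard, hU.reducedSpecZero_eq hP, Finset.card_val]

lemma reducedGam_strictAntiOn : StrictAntiOn (reducedGam P) (Set.Icc 1 (reducedCard P)) := by
  have hnodup : (reducedSpecZero P).Nodup :=
    hU.reducedSpecZero_eq hP ▸ (visibleSpec π U η).nodup
  intro i hi j hj hij
  exact strictAntiOn_getD_sort 0 hnodup (show i - 1 < reducedCard P by grind)
    (show j - 1 < reducedCard P by grind) (by grind)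

lemma image_reducedGam :
    (Finset.Icc 1 (reducedCard P)).image (reducedGam P) = visibleSpec π U η := by
  refine Finset.val_injective ?_
  rw [Finset.image_val_of_injOn (by simpa using (hU.reducedGam_strictAntiOn hP).injOn),
    val_Icc_one_map, ← hU.reducedSpecZero_eq hP]
  exact map_range_getD_sort 0 _

lemma reducedGam_mem {i : ℕ} (hi : i ∈ Set.Icc 1 (reducedCard P)) :
    reducedGam P i ∈ visibleSpec π U η :=
  hU.image_reducedGam hP ▸ Finset.mem_image_of_mem _ (Finset.mem_Icc.2 hi)

lemma eval_visibleSecular_reducedGam {i : ℕ} (hi : i ∈ Set.Icc 1 (reducedCard P)) :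
    (visibleSecular π U η).eval (reducedGam P i) =
      (1 - reducedGam P i) * eigMass π U η (reducedGam P i) *
        ∏ j ∈ (Finset.Icc 1 (reducedCard P)).erase i, (reducedGam P i - reducedGam P j) := by
  rw [visibleSecular, eval_secular_of_mem (hU.reducedGam_mem hP hi), ← hU.image_reducedGam hP,
    prod_erase_image (by simpa using (hU.reducedGam_strictAntiOn hP).injOn)
      (Finset.mem_Icc.2 hi), mul_comm (eigMass _ _ _ _)]

lemma eval_one_visibleSecular :
    (visibleSecular π U η).eval 1 = ∏ i ∈ Finset.Icc 1 (reducedCard P), (1 - reducedGam P i) := by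
  have hne (x : ℝ) (hx : x ∈ visibleSpec π U η) : 1 - x ≠ 0 :=
    (sub_pos.2 (hU.lt_one_of_mem_visibleSpec hP hx)).ne'
  have hmass : ∑ x ∈ visibleSpec π U η, eigMass π U η x * (1 - x) / (1 - x) = 1 - π 0 := by
    rw [← hU.sum_eigCoord_sq (fun m => hP.pos m.succ) hP.distribution.2,
      Finset.sum_congr rfl fun x hx => mul_div_cancel_right₀ _ (hne x hx)]
    exact sum_visibleSpec_fiber fun x hx => hx
  rw [visibleSecular, eval_secular_of_notMem fun h => hne 1 h (sub_self 1), hmass,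
    add_sub_cancel, mul_one, ← hU.image_reducedGam hP,
    Finset.prod_image (by simpa using (hU.reducedGam_strictAntiOn hP).injOn)]

lemma exists_strictlyInterlaced : ∃ lam, StrictlyInterlaced (reducedCard P) lam (reducedGam P) ∧
    (visibleSecular π U η).roots = (Multiset.range (reducedCard P)).map fun i => lam (i + 1) := by
  have hlead := leadingCoeff_visibleSecular (U := U) (η := η) hP
  have hdeg : (visibleSecular π U η).natDegree = reducedCard P :=
    (natDegree_secular (hP.pos 0).ne').trans (hU.card_visibleSpec hP)
  have hlt (i : ℕ) (hi : i ∈ Set.Icc 1 (reducedCard P)) : reducedGam P i < 1 :=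
    hU.lt_one_of_mem_visibleSpec hP (hU.reducedGam_mem hP hi)
  refine exists_strictlyInterlaced_roots hdeg (hlead ▸ hP.pos 0) (hU.reducedGam_strictAntiOn hP)
    hlt fun i hi => ?_
  have hmass : 0 < eigMass π U η (reducedGam P i) :=
    (Finset.sum_nonneg fun k _ => sq_nonneg _).lt_of_ne'
      (mem_visibleSpec.1 (hU.reducedGam_mem hP hi))
  have hprod : ∏ j ∈ (Finset.Icc 1 (reducedCard P)).erase i,
      (reducedGam P i - reducedGam P j) ≠ 0 :=
    Finset.prod_ne_zero_iff.2 fun j hj => sub_ne_zero.2 <|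
      (hU.reducedGam_strictAntiOn hP).injOn.ne hi (Finset.mem_Icc.1 (Finset.mem_of_mem_erase hj))
        (Finset.ne_of_mem_erase hj).symm
  rw [hU.eval_visibleSecular_reducedGam hP hi, mul_assoc]
  exact mul_pos (mul_pos (sub_pos.2 (hlt i hi)) hmass) (mul_self_pos.2 hprod)

lemma strictlyInterlaced_and_roots :
    StrictlyInterlaced (reducedCard P) (reducedLam P) (reducedGam P) ∧
      (visibleSecular π U η).roots =
        (Multiset.range (reducedCard P)).map fun i => reducedLam P (i + 1) := by
  obtain ⟨lam, hlam, hroots⟩ := hU.exists_strictlyInterlaced hP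
  have hspec : reducedSpec P = (Multiset.range (reducedCard P + 1)).map lam := by
    rw [hU.reducedSpec_eq hP, hroots, ← hlam.lam_zero, ← Multiset.coe_range, ← Multiset.coe_range,
      List.range_succ_eq_map]
    simp [Function.comp_def]
  have heq (i : ℕ) (hi : i < reducedCard P + 1) : reducedLam P i = lam i := by
    rw [reducedLam, hspec]
    exact getD_sort_map_range 0 (hlam.lam_strictAntiOn.mono fun i hi =>
      ⟨i.zero_le, Nat.lt_succ_iff.1 hi⟩) hi
  refine ⟨⟨?_, fun i hi => ?_, fun i hi => ?_⟩, ?_⟩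
  · rw [heq 0 (Nat.succ_pos _), hlam.lam_zero]
  · rw [heq i (Nat.lt_succ_iff.2 hi.2)]
    exact hlam.lam_lt i hi
  · rw [heq (i - 1) (by grind)]
    exact hlam.lt_lam i hi
  · rw [hroots]
    exact Multiset.map_congr rfl fun i hi =>
      (heq _ (Nat.succ_lt_succ (Multiset.mem_range.1 hi))).symm

lemma strictlyInterlaced : StrictlyInterlaced (reducedCard P) (reducedLam P) (reducedGam P) :=
  (hU.strictlyInterlaced_and_roots hP).1

lemma card_reducedSpec : (reducedSpec P).card = reducedCard P + 1 := by
  rw [hU.reducedSpec_eq hP, Multiset.card_cons, (hU.strictlyInterlaced_and_roots hP).2,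
    Multiset.card_map, Multiset.card_range]

lemma eval_visibleSecular (x : ℝ) : (visibleSecular π U η).eval x =
    π 0 * ∏ i ∈ Finset.Icc 1 (reducedCard P), (x - reducedLam P i) := by
  have hroots := (hU.strictlyInterlaced_and_roots hP).2
  have hcard : (visibleSecular π U η).roots.card = (visibleSecular π U η).natDegree := by
    rw [hroots, Multiset.card_map, Multiset.card_range, visibleSecular,
      natDegree_secular (hP.pos 0).ne', hU.card_visibleSpec hP]
  have hprod := C_leadingCoeff_mul_prod_multiset_X_sub_C hcard
  rw [leadingCoeff_visibleSecular hP, hroots, ← val_Icc_one_map _ (reducedLam P),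
    Multiset.map_map] at hprod
  rw [← hprod, eval_mul, eval_C]
  exact congrArg _ ((eval_prod _ _ _).trans (by simp))

variable {ρ : ℕ → ℝ} (hρ : ∀ i, ρ i = (1 - reducedGam P i) / (1 - reducedLam P i))
include hρ

lemma prod_rho_eq : ∏ i ∈ Finset.Icc 1 (reducedCard P), ρ i = π 0 := by
  have h := hU.strictlyInterlaced hP
  have heval := hU.eval_one_visibleSecular hP
  rw [hU.eval_visibleSecular hP, h.prod_one_sub_gam hρ] at heval
  refine (mul_right_cancel₀ (Finset.prod_ne_zero_iff.2 fun i hi => ?_) heval).symm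
  exact (sub_pos.2 (h.lam_lt_one i (Finset.mem_Icc.1 hi))).ne'

lemma starDist_eq_eigMass {i : Fin (reducedCard P + 1)} (hi : i ≠ 0) :
    starDist (reducedCard P) ρ (reducedGam P) (reducedCard P) i =
      eigMass π U η (reducedGam P i) := by
  have h := hU.strictlyInterlaced hP
  have hi' := val_mem_Icc hi
  have heq := (h.starDist_mul_prod hρ hi).trans <|
    (hU.prod_rho_eq hP hρ).symm ▸ (hU.eval_visibleSecular hP _).symm.trans
      (hU.eval_visibleSecular_reducedGam hP hi')
  refine mul_left_cancel₀ (sub_pos.2 (h.gam_lt_one _ hi')).ne'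
    (mul_right_cancel₀ (Finset.prod_ne_zero_iff.2 fun j hj => ?_) heq)
  exact sub_ne_zero.2 <| h.gam_strictAntiOn.injOn.ne hi'
    (Finset.mem_Icc.1 (Finset.mem_of_mem_erase hj)) (Finset.ne_of_mem_erase hj).symm

end IsEigenframe

end ReducedSpec

/-! ### Hitting times -/

section HittingTime

variable {Ω Ω' : Type*} [MeasurableSpace Ω] [MeasurableSpace Ω'] {μ : Measure Ω} {μ' : Measure Ω'}

lemma borelSpace_enat : BorelSpace ℕ∞ :=
  ⟨borel_eq_top_of_countable.symm⟩

lemma identDistrib_of_measure_le_eq [IsProbabilityMeasure μ] {T : Ω → ℕ∞} {T' : Ω' → ℕ∞}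
    (hT : AEMeasurable T μ) (hT' : AEMeasurable T' μ') [IsProbabilityMeasure μ']
    (h : ∀ t : ℕ, μ {ω | T ω ≤ t} = μ' {ω | T' ω ≤ t}) : IdentDistrib T T' μ μ' where
  aemeasurable_fst := hT
  aemeasurable_snd := hT'
  map_eq := by
    have := borelSpace_enat
    have := Measure.isProbabilityMeasure_map hT
    refine Measure.ext_of_Iic _ _ fun a => ?_
    rw [Measure.map_apply_of_aemeasurable hT .of_discrete,
      Measure.map_apply_of_aemeasurable hT' .of_discrete]
    induction a using ENat.recTopCoe with
    | top => simp
    | coe t => exact h t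

lemma measure_eq_sum_fiber_inter {α : Type*} [Fintype α] [MeasurableSpace α]
    [MeasurableSingletonClass α] {Y : Ω → α} (hY : Measurable Y) (E : Set Ω) :
    μ E = ∑ i, μ ({ω | Y ω = i} ∩ E) := by
  have hfiber (i : α) : MeasurableSet (Y ⁻¹' {i}) := hY (measurableSet_singleton i)
  have hsum := sum_measure_preimage_singleton (μ := μ.restrict E) Finset.univ fun i _ => hfiber i
  simp only [Measure.restrict_apply (hfiber _)] at hsum
  rw [Finset.coe_univ, Set.preimage_univ, Measure.restrict_apply_univ] at hsum
  exact hsum.symm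

lemma hitZero_le_iff {Ω : Type*} {n : ℕ} {X : ℕ → Ω → Fin (n + 1)} {t : ℕ} {ω : Ω} :
    hitZero X ω ≤ t ↔ ∃ s ≤ t, X s ω = 0 := by
  refine (hittingAfter_le_iff (u := X) (s := {0}) (n := 0) (i := t) (ω := ω)).trans ?_
  simp

lemma setOf_hitZero_le {Ω : Type*} {n : ℕ} (X : ℕ → Ω → Fin (n + 1)) (t : ℕ) :
    {ω | hitZero X ω ≤ t} = {ω | ∀ s ≤ t, X s ω ≠ 0}ᶜ := by
  ext ω
  simp [hitZero_le_iff]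

variable {n : ℕ} {X : ℕ → Ω → Fin (n + 1)} {π : Fin (n + 1) → ℝ}
  {P : Matrix (Fin (n + 1)) (Fin (n + 1)) ℝ}

lemma absorb_mem_rowStochastic (hP : P ∈ rowStochastic ℝ (Fin (n + 1))) :
    absorb P ∈ rowStochastic ℝ (Fin (n + 1)) := by
  refine mem_rowStochastic_iff_sum.2
    ⟨fun i j => ?_, absorb_row_sum (sum_row_of_mem_rowStochastic hP)⟩
  rcases eq_or_ne i 0 with rfl | hi
  · rw [absorb_zero, Pi.single_apply]
    split_ifs <;> norm_num
  · rw [absorb_of_ne P hi]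
    exact nonneg_of_mem_rowStochastic hP

lemma vecMul_mem_stdSimplex {ι : Type*} [Fintype ι] [DecidableEq ι] {A : Matrix ι ι ℝ} {v : ι → ℝ}
    (hA : A ∈ rowStochastic ℝ ι) (hv : v ∈ stdSimplex ℝ ι) : v ᵥ* A ∈ stdSimplex ℝ ι :=
  ⟨nonneg_vecMul_of_mem_rowStochastic hA hv.1,
    (sum_vecMul_of_row_sum (sum_row_of_mem_rowStochastic hA) v).trans hv.2⟩

namespace IsMarkovChain

variable (hX : IsMarkovChain μ X π P)
include hX

lemma measure_path {t : ℕ} (x : Fin (t + 1) → Fin (n + 1)) :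
    μ {ω | ∀ s : Fin (t + 1), X s ω = x s} =
      ENNReal.ofReal (π (x 0) * ∏ s : Fin t, P (x s.castSucc) (x s.succ)) := by
  have hlaw := hX.law t fun s => x (Fin.ofNat (t + 1) s)
  have hval (s : ℕ) (hs : s < t + 1) : Fin.ofNat (t + 1) s = ⟨s, hs⟩ :=
    Fin.ext (Nat.mod_eq_of_lt hs)
  have hset : {ω | ∀ s ≤ t, X s ω = x (Fin.ofNat (t + 1) s)} =
      {ω | ∀ s : Fin (t + 1), X s ω = x s} := by
    ext ω
    simp only [Set.mem_ofPred_eq, Fin.forall_iff, ← Nat.lt_succ_iff]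
    exact forall₂_congr fun s hs => by rw [hval s hs]
  have hprod (s : Fin t) : P (x (Fin.ofNat (t + 1) s)) (x (Fin.ofNat (t + 1) (s + 1))) =
      P (x s.castSucc) (x s.succ) := by
    rw [hval s (Nat.lt_succ_of_lt s.2), hval (s + 1) (Nat.succ_lt_succ s.2)]
    rfl
  rwa [hset, Finset.prod_range, Finset.prod_congr rfl fun s _ => hprod s] at hlaw

lemma measure_path_inter {t : ℕ} (hP : P ∈ rowStochastic ℝ (Fin (n + 1)))
    (x : Fin (t + 1) → Fin (n + 1)) (j : Fin (n + 1)) :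
    μ ({ω | ∀ s : Fin (t + 1), X s ω = x s} ∩ {ω | X (t + 1) ω = j}) =
      μ {ω | ∀ s : Fin (t + 1), X s ω = x s} * ENNReal.ofReal (P (x (Fin.last t)) j) := by
  have hsnoc : {ω | ∀ s : Fin (t + 1), X s ω = x s} ∩ {ω | X (t + 1) ω = j} =
      {ω | ∀ s : Fin (t + 1 + 1), X s ω = (Fin.snoc x j : Fin (t + 1 + 1) → Fin (n + 1)) s} := by
    ext ω
    simp [Fin.forall_fin_succ']
  rw [hsnoc, hX.measure_path, hX.measure_path, Fin.prod_univ_castSucc, ← mul_assoc,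
    ← ENNReal.ofReal_mul' (nonneg_of_mem_rowStochastic hP)]
  simp only [Fin.snoc_castSucc, Fin.succ_castSucc, Fin.succ_last, Fin.snoc_last]
  rw [← Fin.castSucc_zero, Fin.snoc_castSucc (α := fun _ => Fin (n + 1))]

lemma measure_mem_inter {t : ℕ} (hP : P ∈ rowStochastic ℝ (Fin (n + 1)))
    (S : Set (Fin (t + 1) → Fin (n + 1))) {i : Fin (n + 1)} (hS : ∀ x ∈ S, x (Fin.last t) = i)
    (j : Fin (n + 1)) :
    μ ({ω | (fun s : Fin (t + 1) => X s ω) ∈ S} ∩ {ω | X (t + 1) ω = j}) =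
      μ {ω | (fun s : Fin (t + 1) => X s ω) ∈ S} * ENNReal.ofReal (P i j) := by
  lift S to Finset (Fin (t + 1) → Fin (n + 1)) using S.toFinite
  have hfiber (x : Fin (t + 1) → Fin (n + 1)) :
      MeasurableSet ((fun ω (s : Fin (t + 1)) => X s ω) ⁻¹' {x}) :=
    measurable_pi_lambda (fun ω (s : Fin (t + 1)) => X s ω) (fun s => hX.measurable s)
      (measurableSet_singleton x)
  have hpath (x : Fin (t + 1) → Fin (n + 1)) : (fun ω (s : Fin (t + 1)) => X s ω) ⁻¹' {x} =
      {ω | ∀ s : Fin (t + 1), X s ω = x s} := by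
    ext ω
    exact funext_iff
  have hsum := sum_measure_preimage_singleton (μ := μ) S fun x _ => hfiber x
  have hsum' := sum_measure_preimage_singleton (μ := μ.restrict {ω | X (t + 1) ω = j}) S
    fun x _ => hfiber x
  have hnext : MeasurableSet {ω | X (t + 1) ω = j} :=
    hX.measurable (t + 1) (measurableSet_singleton j)
  rw [Measure.restrict_apply' hnext] at hsum'
  refine (hsum'.symm.trans ?_).trans (congrArg (· * _) hsum)
  rw [Finset.sum_mul]
  refine Finset.sum_congr rfl fun x hx => ?_
  rw [Measure.restrict_apply (hfiber x), hpath, ← hS x hx]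
  exact hX.measure_path_inter hP x j

lemma measure_avoid_inter (hP : P ∈ rowStochastic ℝ (Fin (n + 1))) {t : ℕ} (i : Fin (n + 1))
    (j : Fin (n + 1)) :
    μ ({ω | X t ω = i} ∩ {ω | ∀ s ≤ t, X s ω ≠ 0} ∩ {ω | X (t + 1) ω = j}) =
      μ ({ω | X t ω = i} ∩ {ω | ∀ s ≤ t, X s ω ≠ 0}) * ENNReal.ofReal (P i j) := by
  have hset : {ω | X t ω = i} ∩ {ω | ∀ s ≤ t, X s ω ≠ 0} =
      {ω | (fun s : Fin (t + 1) => X s ω) ∈ {x | x (Fin.last t) = i ∧ ∀ s, x s ≠ 0}} := by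
    ext ω
    simp [Fin.forall_iff]
  rw [hset]
  exact hX.measure_mem_inter hP _ (fun x hx => hx.1) j

lemma measure_avoid (hP : P ∈ rowStochastic ℝ (Fin (n + 1)))
    (hπ : π ∈ stdSimplex ℝ (Fin (n + 1))) (t : ℕ) {j : Fin (n + 1)} (hj : j ≠ 0) :
    μ ({ω | X t ω = j} ∩ {ω | ∀ s ≤ t, X s ω ≠ 0}) = ENNReal.ofReal ((π ᵥ* absorb P ^ t) j) := by
  induction t generalizing j with
  | zero =>
    have hset : {ω | X 0 ω = j} ∩ {ω | ∀ s ≤ 0, X s ω ≠ 0} =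
        {ω | ∀ s : Fin 1, X s ω = (fun _ => j) s} := by
      ext ω
      simpa using fun h => h ▸ hj
    rw [hset, hX.measure_path]
    simp
  | succ t ih =>
    have hnonneg (i : Fin (n + 1)) : 0 ≤ (π ᵥ* absorb P ^ t) i :=
      (vecMul_mem_stdSimplex (pow_mem (absorb_mem_rowStochastic hP) t) hπ).1 i
    have hset : {ω | X (t + 1) ω = j} ∩ {ω | ∀ s ≤ t + 1, X s ω ≠ 0} =
        {ω | ∀ s ≤ t, X s ω ≠ 0} ∩ {ω | X (t + 1) ω = j} := by
      ext ω
      simp only [Nat.le_succ_iff, Set.mem_inter_iff, Set.mem_ofPred_eq]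
      grind
    rw [hset, measure_eq_sum_fiber_inter (hX.measurable t), pow_succ, ← vecMul_vecMul, vecMul,
      dotProduct, ENNReal.ofReal_sum_of_nonneg fun i _ => mul_nonneg (hnonneg i)
        (nonneg_of_mem_rowStochastic (absorb_mem_rowStochastic hP))]
    refine Finset.sum_congr rfl fun i _ => ?_
    rw [← Set.inter_assoc, hX.measure_avoid_inter hP]
    rcases eq_or_ne i 0 with rfl | hi
    · have hempty : {ω | X t ω = 0} ∩ {ω | ∀ s ≤ t, X s ω ≠ 0} = ∅ :=
        Set.disjoint_iff_inter_eq_empty.1 (Set.disjoint_left.2 fun ω h0 h => h t le_rfl h0)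
      simp [hempty, absorb_zero, hj]
    · rw [ih hi, absorb_of_ne P hi, ENNReal.ofReal_mul (hnonneg i)]

lemma measure_forall_ne_zero (hP : P ∈ rowStochastic ℝ (Fin (n + 1)))
    (hπ : π ∈ stdSimplex ℝ (Fin (n + 1))) (t : ℕ) :
    μ {ω | ∀ s ≤ t, X s ω ≠ 0} = ENNReal.ofReal (1 - (π ᵥ* absorb P ^ t) 0) := by
  have hv := vecMul_mem_stdSimplex (pow_mem (absorb_mem_rowStochastic hP) t) hπ
  have hempty : {ω | X t ω = 0} ∩ {ω | ∀ s ≤ t, X s ω ≠ 0} = ∅ :=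
    Set.disjoint_iff_inter_eq_empty.1 (Set.disjoint_left.2 fun ω h0 h => h t le_rfl h0)
  rw [measure_eq_sum_fiber_inter (hX.measurable t), ← hv.2, Fin.sum_univ_succ, Fin.sum_univ_succ,
    add_sub_cancel_left, hempty, measure_empty, zero_add,
    ENNReal.ofReal_sum_of_nonneg fun i _ => hv.1 _]
  exact Finset.sum_congr rfl fun i _ => hX.measure_avoid hP hπ t i.succ_ne_zero

lemma measurable_hitZero : Measurable (hitZero X) := by
  have := borelSpace_enat
  refine measurable_of_Iic fun a => ?_
  induction a using ENat.recTopCoe with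
  | top => simp
  | coe t =>
    have hset : hitZero X ⁻¹' Set.Iic (t : ℕ∞) = ⋃ s, ⋃ (_ : s ≤ t), X s ⁻¹' {0} := by
      ext ω
      simpa using hitZero_le_iff
    exact hset ▸ .iUnion fun s => .iUnion fun _ => hX.measurable s (measurableSet_singleton 0)

lemma measure_hitZero_le (hP : P ∈ rowStochastic ℝ (Fin (n + 1)))
    (hπ : π ∈ stdSimplex ℝ (Fin (n + 1))) (t : ℕ) :
    μ {ω | hitZero X ω ≤ t} = ENNReal.ofReal ((π ᵥ* absorb P ^ t) 0) := by
  have := hX.isProbabilityMeasure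
  have hv := vecMul_mem_stdSimplex (pow_mem (absorb_mem_rowStochastic hP) t) hπ
  have hzero : (π ᵥ* absorb P ^ t) 0 ≤ 1 :=
    (Finset.single_le_sum (fun i _ => hv.1 i) (Finset.mem_univ 0)).trans_eq hv.2
  have hmeas : MeasurableSet {ω | ∀ s ≤ t, X s ω ≠ 0} :=
    .of_compl (setOf_hitZero_le X t ▸ hX.measurable_hitZero (.of_discrete (s := Set.Iic (t : ℕ∞))))
  rw [setOf_hitZero_le, prob_compl_eq_one_sub hmeas, hX.measure_forall_ne_zero hP hπ,
    ← ENNReal.ofReal_one, ← ENNReal.ofReal_sub _ (sub_nonneg.2 hzero), sub_sub_cancel]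

end IsMarkovChain

lemma IsQuasiIntertwining.identDistrib_hitZero {m : ℕ} {Λ : Matrix (Fin (m + 1)) (Fin (n + 1)) ℝ}
    {X' : ℕ → Ω' → Fin (m + 1)} {π' : Fin (m + 1) → ℝ} {P' : Matrix (Fin (m + 1)) (Fin (m + 1)) ℝ}
    (h : IsQuasiIntertwining Λ π (absorb P) π' (absorb P')) (h0 : MatchesZero Λ)
    (hX : IsMarkovChain μ X π P) (hP : P ∈ rowStochastic ℝ (Fin (n + 1)))
    (hπ : π ∈ stdSimplex ℝ (Fin (n + 1))) (hX' : IsMarkovChain μ' X' π' P')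
    (hP' : P' ∈ rowStochastic ℝ (Fin (m + 1))) (hπ' : π' ∈ stdSimplex ℝ (Fin (m + 1))) :
    IdentDistrib (hitZero X) (hitZero X') μ μ' := by
  have := hX.isProbabilityMeasure
  have := hX'.isProbabilityMeasure
  refine identDistrib_of_measure_le_eq hX.measurable_hitZero.aemeasurable
    hX'.measurable_hitZero.aemeasurable fun t => ?_
  rw [hX.measure_hitZero_le hP hπ, hX'.measure_hitZero_le hP' hπ', h.vecMul_pow_apply_zero h0]

end HittingTime

/-! ### Sums of independent modified geometric variables -/

section ModifiedGeo

variable {r : ℕ} {ρ γ : ℕ → ℝ}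

variable (ρ γ) in
lemma hatMatrix_pow_zero (t : ℕ) : (hatMatrix r ρ γ ^ t) 0 = Pi.single 0 1 := by
  induction t with
  | zero => exact funext fun j => by rw [pow_zero, one_eq_pi_single]
  | succ t ih =>
    rw [pow_succ, mul_apply_eq_vecMul, ih, single_one_vecMul]
    exact hatMatrix_zero ρ γ

lemma hatMatrix_pow_succ_apply_zero (i : Fin r) (t : ℕ) :
    (hatMatrix r ρ γ ^ t) i.succ 0 = ∑ s ∈ Finset.range t,
      γ (i + 1) ^ s * (1 - γ (i + 1)) *
        (hatDist r ρ i ᵥ* hatMatrix r ρ γ ^ (t - (s + 1))) 0 := by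
  induction t with
  | zero => simp
  | succ t ih =>
    rw [pow_succ', mul_apply_eq_vecMul, hatMatrix_succ, add_vecMul, smul_vecMul, smul_vecMul,
      single_one_vecMul, Finset.sum_range_succ', add_comm, Pi.add_apply, Pi.smul_apply,
      Pi.smul_apply, smul_eq_mul, smul_eq_mul, row, ih, Finset.mul_sum]
    simp only [Nat.add_sub_add_right, pow_succ', mul_assoc, pow_zero, one_mul, zero_add,
      Nat.add_sub_cancel]

lemma hatDist_succ_vecMul_hatMatrix_pow (i : Fin r) (t : ℕ) :
    (hatDist r ρ (i + 1) ᵥ* hatMatrix r ρ γ ^ t) 0 =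
      ρ (i + 1) * (hatDist r ρ i ᵥ* hatMatrix r ρ γ ^ t) 0 +
        ∑ s ∈ Finset.range t, (1 - ρ (i + 1)) * (γ (i + 1) ^ s * (1 - γ (i + 1))) *
          (hatDist r ρ i ᵥ* hatMatrix r ρ γ ^ (t - (s + 1))) 0 := by
  rw [hatDist_succ, add_vecMul, smul_vecMul, smul_vecMul, single_one_vecMul, Pi.add_apply,
    Pi.smul_apply, Pi.smul_apply, smul_eq_mul, smul_eq_mul, row, hatMatrix_pow_succ_apply_zero,
    Finset.mul_sum]
  simp only [mul_assoc]

lemma geo_singleton_zero (p : ℝ) : geo p {0} = 0 := by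
  rw [geo, Measure.map_apply .of_discrete (measurableSet_singleton 0)]
  exact (congrArg _ (Set.preimage_singleton_eq_empty.2 (by simp))).trans measure_empty

lemma geo_singleton_succ {p : ℝ} (hp : p ∈ Set.Ioc 0 1) (k : ℕ) :
    geo p {k + 1} = ENNReal.ofReal ((1 - p) ^ k * p) := by
  have hproj : Set.projIcc 0 1 zero_le_one p = ⟨p, hp.1.le, hp.2⟩ :=
    Set.projIcc_of_mem _ ⟨hp.1.le, hp.2⟩
  have hpre : (· + 1) ⁻¹' {k + 1} = ({k} : Set ℕ) := by
    ext x
    simp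
  rw [geo, Measure.map_apply .of_discrete (measurableSet_singleton _), hproj, hpre,
    geometricMeasure_singleton fun h => hp.1.ne' (congrArg Subtype.val h)]

lemma modifiedGeo_singleton_zero (q p : ℝ) : modifiedGeo q p {0} = ENNReal.ofReal q := by
  simp [modifiedGeo, geo_singleton_zero]

lemma modifiedGeo_singleton_succ {q p : ℝ} (hq : q ≤ 1) (hp : p ∈ Set.Ioc 0 1) (k : ℕ) :
    modifiedGeo q p {k + 1} = ENNReal.ofReal ((1 - q) * ((1 - p) ^ k * p)) := by
  rw [ENNReal.ofReal_mul (sub_nonneg.2 hq), ← geo_singleton_succ hp]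
  simp [modifiedGeo]

variable {Ω : Type*} [MeasurableSpace Ω] {μ : Measure Ω}

lemma measure_add_le_eq_sum {S Y : Ω → ℕ} (hS : AEMeasurable S μ) (hY : AEMeasurable Y μ)
    (h : IndepFun S Y μ) (t : ℕ) :
    μ {ω | S ω + Y ω ≤ t} = ∑ k ∈ Finset.range (t + 1), μ.map Y {k} * μ {ω | S ω ≤ t - k} := by
  have hunion : {ω | S ω + Y ω ≤ t} =
      ⋃ k ∈ Finset.range (t + 1), (S ⁻¹' Set.Iic (t - k) ∩ Y ⁻¹' {k}) := by
    ext ω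
    simp only [Set.mem_ofPred_eq, Finset.mem_range, Set.mem_iUnion, Set.mem_inter_iff,
      Set.mem_preimage, Set.mem_Iic, Set.mem_singleton_iff, exists_prop]
    exact ⟨fun h => ⟨Y ω, by lia, by lia, rfl⟩, fun ⟨k, hk, hS, hY⟩ => by lia⟩
  rw [hunion, measure_biUnion_finset₀]
  · refine Finset.sum_congr rfl fun k _ => ?_
    rw [h.measure_inter_preimage_eq_mul _ _ .of_discrete .of_discrete, mul_comm,
      Measure.map_apply_of_aemeasurable hY .of_discrete]
    rfl
  · intro i _ j _ hij
    refine (Set.disjoint_left.2 ?_).aedisjoint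
    rintro ω ⟨-, hi⟩ ⟨-, hj⟩
    exact hij (hi.symm.trans hj)
  · intro k _
    exact (hS.nullMeasurable .of_discrete).inter (hY.nullMeasurable .of_discrete)

lemma measure_add_modifiedGeo_le {S Y : Ω → ℕ} {q p : ℝ} (hq : q ∈ Set.Icc 0 1)
    (hp : p ∈ Set.Ioc 0 1) (hS : AEMeasurable S μ) (hY : HasLaw Y (modifiedGeo q p) μ)
    (h : IndepFun S Y μ) {F : ℕ → ℝ} (hF : ∀ t, 0 ≤ F t)
    (hSF : ∀ t, μ {ω | S ω ≤ t} = ENNReal.ofReal (F t)) (t : ℕ) :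
    μ {ω | S ω + Y ω ≤ t} = ENNReal.ofReal (q * F t +
      ∑ s ∈ Finset.range t, (1 - q) * ((1 - p) ^ s * p) * F (t - (s + 1))) := by
  have hweight (s : ℕ) : 0 ≤ (1 - q) * ((1 - p) ^ s * p) :=
    mul_nonneg (sub_nonneg.2 hq.2) (mul_nonneg (pow_nonneg (sub_nonneg.2 hp.2) s) hp.1.le)
  rw [measure_add_le_eq_sum hS hY.aemeasurable h, hY.map_eq, Finset.sum_range_succ', add_comm,
    modifiedGeo_singleton_zero, hSF, Nat.sub_zero, ← ENNReal.ofReal_mul hq.1,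
    ENNReal.ofReal_add (mul_nonneg hq.1 (hF t))
      (Finset.sum_nonneg fun s _ => mul_nonneg (hweight s) (hF _)),
    ENNReal.ofReal_sum_of_nonneg fun s _ => mul_nonneg (hweight s) (hF _)]
  refine congrArg _ (Finset.sum_congr rfl fun s _ => ?_)
  rw [modifiedGeo_singleton_succ hq.2 hp, hSF, ENNReal.ofReal_mul (hweight s)]

lemma measure_sum_modifiedGeo_le [IsProbabilityMeasure μ]
    (hρ : ∀ i ∈ Set.Icc 1 r, ρ i ∈ Set.Icc 0 1) (hγ : ∀ i ∈ Set.Icc 1 r, γ i ∈ Set.Ico 0 1)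
    {k : ℕ} (hk : k ≤ r) {Y : Fin k → Ω → ℕ} (hY : iIndepFun Y μ)
    (hlaw : ∀ i : Fin k, HasLaw (Y i) (modifiedGeo (ρ (i + 1)) (1 - γ (i + 1))) μ) (t : ℕ) :
    μ {ω | ∑ i, Y i ω ≤ t} =
      ENNReal.ofReal ((hatDist r ρ k ᵥ* hatMatrix r ρ γ ^ t) 0) := by
  induction k generalizing t with
  | zero =>
    rw [hatDist_zero, single_one_vecMul, row, hatMatrix_pow_zero]
    simp
  | succ k ih =>
    have hk' := val_succ_mem_Icc ⟨k, hk⟩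
    have hp : 1 - γ (k + 1) ∈ Set.Ioc 0 1 :=
      ⟨sub_pos.2 (hγ _ hk').2, sub_le_self _ (hγ _ hk').1⟩
    have hF (t : ℕ) : 0 ≤ (hatDist r ρ k ᵥ* hatMatrix r ρ γ ^ t) 0 :=
      nonneg_vecMul_of_mem_rowStochastic
        (pow_mem (hatMatrix_mem_rowStochastic hρ fun i hi => Set.Ico_subset_Icc_self (hγ i hi)) t)
        (hatDist_mem_stdSimplex hρ (Nat.le_of_succ_le hk)).1 0
    have hindep : IndepFun (fun ω => ∑ i : Fin k, Y i.castSucc ω) (Y (Fin.last k)) μ := by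
      have h := hY.indepFun_finsetSum_of_notMem₀ (fun i => (hlaw i).aemeasurable)
        (s := Finset.univ.map Fin.castSuccEmb) (i := Fin.last k) (by simp)
      convert h using 1
      ext ω
      simp
    have hstep := measure_add_modifiedGeo_le (hρ _ hk') hp
      (Finset.univ.aemeasurable_fun_sum fun i _ => (hlaw (Fin.castSucc i)).aemeasurable)
      (hlaw (Fin.last k)) hindep hF
      (ih (Nat.le_of_succ_le hk) (hY.precomp (Fin.castSucc_injective k)) fun i => hlaw i.castSucc) t
    simp only [Fin.sum_univ_castSucc]
    rw [hstep, hatDist_succ_vecMul_hatMatrix_pow ⟨k, hk⟩, sub_sub_cancel]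

end ModifiedGeo

section Main

variable {n : ℕ} {P : Matrix (Fin (n + 1)) (Fin (n + 1)) ℝ} {π : Fin (n + 1) → ℝ}

namespace IsEigenframe

variable {U : Matrix (Fin n) (Fin n) ℝ} {η : Fin n → ℝ} (hU : IsEigenframe P π U η)
  (hP : IsReversibleIrreducible P π) {ρ : ℕ → ℝ}
  (hρ : ∀ i, ρ i = (1 - reducedGam P i) / (1 - reducedLam P i))
include hU hP hρ

lemma matchesZero_linkOne : MatchesZero (linkOne (reducedCard P) ρ (reducedGam P) π U η) :=
  InterlacedHitting.matchesZero_linkOne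
    (fun i hi => ((hU.strictlyInterlaced hP).starDist_pos hρ le_rfl hi i.is_le).ne')
    fun _ hi => hU.starDist_eq_eigMass hP hρ hi

lemma isQuasiIntertwining_linkOne :
    IsQuasiIntertwining (linkOne (reducedCard P) ρ (reducedGam P) π U η) π (absorb P)
      (starDist (reducedCard P) ρ (reducedGam P) (reducedCard P))
      (absorb (starMatrix (reducedCard P) ρ (reducedGam P))) where
  row_sum := linkOne_row_sum
  intertwine := linkOne_mul_absorb (sum_row_of_mem_rowStochastic hP.stochastic)
    (fun m => hP.pos m.succ) hU
  initial := by
    have h := hU.strictlyInterlaced hP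
    have hγ := h.gam_strictAntiOn.injOn
    exact (starDist_vecMul_linkOne (fun m => hP.pos m.succ) hP.distribution.2 hU
      (fun i hi => (h.starDist_pos hρ le_rfl hi i.is_le).ne')
      (sum_starDist hγ (fun i hi => (h.gam_lt_one i hi).ne) le_rfl) hγ
      (hU.image_reducedGam hP)).symm

end IsEigenframe

lemma IsReversibleIrreducible.strictlyInterlaced (hP : IsReversibleIrreducible P π) :
    StrictlyInterlaced (reducedCard P) (reducedLam P) (reducedGam P) := by
  obtain ⟨U, η, hU⟩ := exists_isEigenframe (fun m => hP.pos m.succ) hP.reversible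
  exact hU.strictlyInterlaced hP

lemma IsQuasiIntertwining.identDistrib_hitZero_sum {Ω Ω' : Type*} [MeasurableSpace Ω]
    [MeasurableSpace Ω'] {μ : Measure Ω} {μ' : Measure Ω'} [IsProbabilityMeasure μ'] {r : ℕ}
    {ρ γ : ℕ → ℝ} {Λ : Matrix (Fin (r + 1)) (Fin (n + 1)) ℝ} {X : ℕ → Ω → Fin (n + 1)}
    {Y : Fin r → Ω' → ℕ}
    (h : IsQuasiIntertwining Λ π (absorb P) (hatDist r ρ r) (hatMatrix r ρ γ))
    (h0 : MatchesZero Λ) (hρ : ∀ i ∈ Set.Icc 1 r, ρ i ∈ Set.Icc 0 1)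
    (hγ : ∀ i ∈ Set.Icc 1 r, γ i ∈ Set.Ico 0 1) (hX : IsMarkovChain μ X π P)
    (hP : P ∈ rowStochastic ℝ (Fin (n + 1))) (hπ : π ∈ stdSimplex ℝ (Fin (n + 1)))
    (hY : iIndepFun Y μ')
    (hlaw : ∀ i : Fin r, HasLaw (Y i) (modifiedGeo (ρ (i + 1)) (1 - γ (i + 1))) μ') :
    IdentDistrib (hitZero X) (fun ω => ((∑ i, Y i ω : ℕ) : ℕ∞)) μ μ' := by
  have := hX.isProbabilityMeasure
  have hsum : AEMeasurable (fun ω => ∑ i, Y i ω) μ' :=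
    Finset.univ.aemeasurable_fun_sum fun i _ => (hlaw i).aemeasurable
  refine identDistrib_of_measure_le_eq hX.measurable_hitZero.aemeasurable
    (Measurable.of_discrete.comp_aemeasurable hsum) fun t => ?_
  simp only [Nat.cast_le]
  rw [hX.measure_hitZero_le hP hπ, h.vecMul_pow_apply_zero h0,
    measure_sum_modifiedGeo_le hρ hγ le_rfl hY hlaw]

end Main

end InterlacedHitting

end

open InterlacedHitting in
theorem theorem3p9_general {n : ℕ} (P : Matrix (Fin (n + 1)) (Fin (n + 1)) ℝ)
    (π : Fin (n + 1) → ℝ) (hP : IsReversibleIrreducible P π)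
    (r : ℕ) (hr : r = reducedCard P)
    (lam gam ρ : ℕ → ℝ) (hlam : lam = reducedLam P) (hgam : gam = reducedGam P)
    (hρ : ∀ i, ρ i = (1 - gam i) / (1 - lam i))
    (hnonneg : ∀ i ∈ Set.Icc 1 r, 0 ≤ gam i) :
    ((reducedSpec P).card = r + 1 ∧ lam 0 = 1 ∧
      ∀ i, 1 ≤ i → i ≤ r → lam i < gam i ∧ gam i < lam (i - 1)) ∧
    (hatDist r ρ r ∈ stdSimplex ℝ (Fin (r + 1)) ∧
      hatMatrix r ρ gam ∈ Matrix.rowStochastic ℝ (Fin (r + 1))) ∧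
    ((∀ i j, 0 ≤ linkTwo r ρ gam i j) ∧
      IsQuasiIntertwining (linkTwo r ρ gam) (starDist r ρ gam r) (absorb (starMatrix r ρ gam))
        (hatDist r ρ r) (hatMatrix r ρ gam) ∧
      MatchesZero (linkTwo r ρ gam)) ∧
    (∃ U η, IsEigenframe P π U η) ∧
    (∀ U η, IsEigenframe P π U η →
      (IsQuasiIntertwining (linkOne r ρ gam π U η) π (absorb P)
          (starDist r ρ gam r) (absorb (starMatrix r ρ gam)) ∧
        MatchesZero (linkOne r ρ gam π U η)) ∧
      (IsQuasiIntertwining (linkTwo r ρ gam * linkOne r ρ gam π U η) π (absorb P)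
          (hatDist r ρ r) (hatMatrix r ρ gam) ∧
        MatchesZero (linkTwo r ρ gam * linkOne r ρ gam π U η))) ∧
    (∀ (Ω : Type*) (_ : MeasurableSpace Ω) (μ : Measure Ω) (X : ℕ → Ω → Fin (n + 1))
        (Ω' : Type*) (_ : MeasurableSpace Ω') (μ' : Measure Ω') (X' : ℕ → Ω' → Fin (r + 1)),
      IsMarkovChain μ X π P → IsMarkovChain μ' X' (hatDist r ρ r) (hatMatrix r ρ gam) →
      IdentDistrib (hitZero X) (hitZero X') μ μ') ∧
    (∀ (Ω : Type*) (_ : MeasurableSpace Ω) (μ : Measure Ω) (X : ℕ → Ω → Fin (n + 1))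
        (Ω' : Type*) (_ : MeasurableSpace Ω') (μ' : Measure Ω') (Y : Fin r → Ω' → ℕ),
      IsMarkovChain μ X π P → IsProbabilityMeasure μ' → iIndepFun Y μ' →
      (∀ i : Fin r, HasLaw (Y i) (modifiedGeo (ρ ((i : ℕ) + 1)) (1 - gam ((i : ℕ) + 1))) μ') →
      IdentDistrib (hitZero X) (fun ω => ((∑ i, Y i ω : ℕ) : ℕ∞)) μ μ') := by
  subst hr hlam hgam
  obtain ⟨U₀, η₀, hU₀⟩ := exists_isEigenframe (fun m => hP.pos m.succ) hP.reversible
  have hlace := hP.strictlyInterlaced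
  have hρmem := hlace.rho_mem_Icc hρ
  have hγmem := fun i hi => Set.mem_Ico.2 ⟨hnonneg i hi, hlace.gam_lt_one i hi⟩
  have hdist := hatDist_mem_stdSimplex hρmem le_rfl
  have hstoch := hatMatrix_mem_rowStochastic hρmem fun i hi => Set.Ico_subset_Icc_self (hγmem i hi)
  have hlink₂ := isQuasiIntertwining_linkTwo hlace.gam_strictAntiOn.injOn
    (fun i hi => (hlace.gam_lt_one i hi).ne) fun i hi => (hlace.rho_lt_one hρ i hi).ne
  have hlink (U η) (hU : IsEigenframe P π U η) := hlink₂.mul (hU.isQuasiIntertwining_linkOne hP hρ)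
  have hzero₂ : MatchesZero (linkTwo (reducedCard P) ρ (reducedGam P)) := matchesZero_linkTwo
  have hzero (U η) (hU : IsEigenframe P π U η) := hzero₂.mul (hU.matchesZero_linkOne hP hρ)
  refine ⟨⟨hU₀.card_reducedSpec hP, hlace.lam_zero, fun i h1 hr =>
      ⟨hlace.lam_lt i ⟨h1, hr⟩, hlace.lt_lam i ⟨h1, hr⟩⟩⟩, ⟨hdist, hstoch⟩,
    ⟨hlace.linkTwo_nonneg hρ, hlink₂, hzero₂⟩, ⟨U₀, η₀, hU₀⟩,
    fun U η hU => ⟨⟨hU.isQuasiIntertwining_linkOne hP hρ, hU.matchesZero_linkOne hP hρ⟩,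
      hlink U η hU, hzero U η hU⟩, fun Ω _ μ X Ω' _ μ' X' hX hX' => ?_,
    fun Ω _ μ X Ω' _ μ' Y hX _ hY hlaw => (hlink U₀ η₀ hU₀).identDistrib_hitZero_sum
      (hzero U₀ η₀ hU₀) hρmem hγmem hX hP.stochastic hP.distribution hY hlaw⟩
  rw [← absorb_hatMatrix] at hlink
  exact (hlink U₀ η₀ hU₀).identDistrib_hitZero (hzero U₀ η₀ hU₀) hX hP.stochastic hP.distribution
    hX' hstoch hdist

open InterlacedHitting in
theorem theorem3p9 {n : ℕ} (P : Matrix (Fin (n + 1)) (Fin (n + 1)) ℝ)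
    (π : Fin (n + 1) → ℝ) (hP : IsReversibleErgodic P π)
    (r : ℕ) (hr : r = reducedCard P)
    (lam gam ρ : ℕ → ℝ) (hlam : lam = reducedLam P) (hgam : gam = reducedGam P)
    (hρ : ∀ i, ρ i = (1 - gam i) / (1 - lam i))
    (hnonneg : 0 ≤ lam r) :
    -- the reduced spectra have `r + 1` and `r` elements and strictly interlace
    ((reducedSpec P).card = r + 1 ∧ lam 0 = 1 ∧
      ∀ i, 1 ≤ i → i ≤ r → lam i < gam i ∧ gam i < lam (i - 1)) ∧
    -- `(π̂, P̂)` is a Markov chain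
    (hatDist r ρ r ∈ stdSimplex ℝ (Fin (r + 1)) ∧
      hatMatrix r ρ gam ∈ Matrix.rowStochastic ℝ (Fin (r + 1))) ∧
    -- `Λ₂` is a link between `(π*, P*_abs)` and `(π̂, P̂)`
    ((∀ i j, 0 ≤ linkTwo r ρ gam i j) ∧
      IsQuasiIntertwining (linkTwo r ρ gam) (starDist r ρ gam r) (absorb (starMatrix r ρ gam))
        (hatDist r ρ r) (hatMatrix r ρ gam) ∧
      MatchesZero (linkTwo r ρ gam)) ∧
    -- eigenframes exist, and for each of them `Λ₁` and `Λ = Λ₂ Λ₁` are quasi-links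
    (∃ U η, IsEigenframe P π U η) ∧
    (∀ U η, IsEigenframe P π U η →
      (IsQuasiIntertwining (linkOne r ρ gam π U η) π (absorb P)
          (starDist r ρ gam r) (absorb (starMatrix r ρ gam)) ∧
        MatchesZero (linkOne r ρ gam π U η)) ∧
      (IsQuasiIntertwining (linkTwo r ρ gam * linkOne r ρ gam π U η) π (absorb P)
          (hatDist r ρ r) (hatMatrix r ρ gam) ∧
        MatchesZero (linkTwo r ρ gam * linkOne r ρ gam π U η))) ∧
    -- equality of the hitting-time laws of the given chain and the downward chain
    (∀ (Ω : Type*) (_ : MeasurableSpace Ω) (μ : Measure Ω) (X : ℕ → Ω → Fin (n + 1))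
        (Ω' : Type*) (_ : MeasurableSpace Ω') (μ' : Measure Ω') (X' : ℕ → Ω' → Fin (r + 1)),
      IsMarkovChain μ X π P → IsMarkovChain μ' X' (hatDist r ρ r) (hatMatrix r ρ gam) →
      IdentDistrib (hitZero X) (hitZero X') μ μ') ∧
    -- the hitting time is distributed as a sum of independent modified geometric variables
    (∀ (Ω : Type*) (_ : MeasurableSpace Ω) (μ : Measure Ω) (X : ℕ → Ω → Fin (n + 1))
        (Ω' : Type*) (_ : MeasurableSpace Ω') (μ' : Measure Ω') (Y : Fin r → Ω' → ℕ),
      IsMarkovChain μ X π P → IsProbabilityMeasure μ' → iIndepFun Y μ' →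
      (∀ i : Fin r, HasLaw (Y i) (modifiedGeo (ρ ((i : ℕ) + 1)) (1 - gam ((i : ℕ) + 1))) μ') →
      IdentDistrib (hitZero X) (fun ω => ((∑ i, Y i ω : ℕ) : ℕ∞)) μ μ')
    := by
  subst hr hlam hgam
  have hlace := hP.isReversibleIrreducible.strictlyInterlaced
  exact theorem3p9_general P π hP.isReversibleIrreducible _ rfl _ _ ρ rfl rfl hρ fun i hi =>
    (hlace.gam_pos hnonneg i hi).le
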